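/- Let $p$ be an odd prime, $m\ge 1$, and for $m$ fixed let $\mathbb Q_p^{(m)}$ be the unramified extension of $\mathbb Q_p$ of degree $m$ in $\overline{\mathbb Q_p}$, with the norm $|\cdot|_p$ and the ring of integers $\mathbb Z_p^{(m)}=\{a : |a|_p\le 1\}$. Let $t=(t_1,\dots,t_r)$, $z=(z_1,\dots,z_n)$. Let $\mathbf e=(e_1,e_2,\dots)$ be a sequence of positive integers, $\Delta=(\Delta_0,\Delta_1,\dots)$ a sequence of subsets of $\mathbb Z^r$, all with the same number $g\ge 1$ of elements (each given with an enumeration, so that matrices indexed by $\Delta_i\times\Delta_j$ are $g\times g$ matrices), and $\Lambda=(\Lambda_0,\Lambda_1,\dots)$ a sequence of Laurent polynomials in $\mathbb Z_p[t^{\pm1},z^{\pm1}]$; assume that each of the three sequences has only finitely many distinct entries. Notation. For a Laurent polynomial $F(t,z)$ let $N(F)\subset\mathbb R^r$ be its Newton polytope with respect to $t$ only, let $\operatorname{Coeff}_vF\in\mathbb Z_p[z^{\pm1}]$ be the coefficient of $t^v$, and for finite $\Delta',\Delta''\subset\mathbb Z^r$ and $M\ge 0$ put $$A(M,\Delta',\Delta'',F)=\big(\operatorname{Coeff}_{p^Mv-u}F\big)_{u\in\Delta',\,v\in\Delta''}.$$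 Put $\sigma(G)(z)=G(z^p)$ for $G\in\mathbb Z_p[z^{\pm1}]$, applied entrywise to matrices, and $$W_s^{(j)}=\Lambda_j\,\Lambda_{j+1}^{p^{e_{j+1}}}\cdots\Lambda_s^{p^{e_{j+1}+\dots+e_s}},\qquad W_s=W_s^{(0)},\qquad W_0^{(1)}=1.$$ Assume that $\Lambda$ is $(\Delta,\mathbf e)$-admissible: for all $0\le i\le j$, $$\big(\Delta_i+N(\Lambda_i)+p^{e_{i+1}}N(\Lambda_{i+1})+\dots+p^{e_{i+1}+\dots+e_j}N(\Lambda_j)\big)\cap p^{e_{i+1}+\dots+e_{j+1}}\mathbb Z^r\subset p^{e_{i+1}+\dots+e_{j+1}}\Delta_{j+1};$$ and nondegenerate: for every $l\ge 0$ the Laurent polynomial $d_l(z)=\det A(e_{l+1},\Delta_l,\Delta_{l+1},\Lambda_l)$ is nonzero modulo $p$. Let $\mathfrak D^{(m)}$ be the set of all $a\in(\mathbb Z_p^{(m)})^n$ such that $|d_l(a)|_p=1$ for all $l\ge 0$; here, for the Laurent polynomials to be defined at $a$ over $\mathbb Z_p^{(m)}$, it is required that $|a_i|_p=1$ for every $i$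 such that $z_i$ occurs with a negative exponent in some $\Lambda_l$ (no requirement if the $\Lambda_l$ are polynomials in $z$). Then for every $s\ge 0$ the Laurent polynomial $$\det\sigma^{e_1}\big(A(e_2+\dots+e_{s+1},\Delta_1,\Delta_{s+1},W_s^{(1)})\big)$$ is nonzero modulo $p$ and has norm $1$ at every point of $\mathfrak D^{(m)}$, so that the entries of $$A\big(e_1+\dots+e_{s+1},\Delta_0,\Delta_{s+1},W_s\big)\cdot\sigma^{e_1}\big(A(e_2+\dots+e_{s+1},\Delta_1,\Delta_{s+1},W_s^{(1)})\big)^{-1}$$ are rational functions in $z$ regular on $\mathfrak D^{(m)}$. As $s\to\infty$ these matrices converge uniformly on $\mathfrak D^{(m)}$ to a $g\times g$ matrix $\mathcal A_\Lambda(z)$ with values in $\mathbb Z_p^{(m)}$ that is analytic: $\mathfrak D^{(m)}$ contains, with each of its points $a$, the unit polydisc $\{b\in(\mathbb Q_p^{(m)})^n : |b_i-a_i|_p<1 \text{ for all } i\}$, and on this polydisc every entry of $\mathcal A_\Lambda$ is the sum of a power series in $z-a$ that converges on the whole polydisc. For every $a\in\mathfrak D^{(m)}$ we have $|\det\mathcal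 A_\Lambda(a)|_p=1$, and the matrix $\mathcal A_\Lambda(a)$ is invertible. -/

import Mathlib

open scoped Pointwise

noncomputable section

namespace Dwork

/-- The Laurent polynomial ring `ℤ_p[z₁^{±1}, …, z_n^{±1}]`: exponents are vectors in `ℤⁿ`. -/
abbrev LaurentZ (p : ℕ) [Fact p.Prime] (n : ℕ) : Type :=
  AddMonoidAlgebra ℤ_[p] (Fin n → ℤ)

/-- The Laurent polynomial ring `ℤ_p[t₁^{±1}, …, t_r^{±1}, z₁^{±1}, …, z_n^{±1}]`: an exponent is
a pair consisting of the exponent of `t` and the exponent of `z`. -/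
abbrev LaurentTZ (p : ℕ) [Fact p.Prime] (r n : ℕ) : Type :=
  AddMonoidAlgebra ℤ_[p] ((Fin r → ℤ) × (Fin n → ℤ))

/-- The unramified extension `ℚ_p^{(m)}` of degree `m ≥ 1` of `ℚ_p` inside the algebraic closure of
`ℚ_p`, obtained by adjoining the roots of unity of order dividing `p ^ m - 1`. It carries the norm
of the algebraic closure, which extends `|·|_p`. -/
abbrev Qpm (p : ℕ) [Fact p.Prime] (m : ℕ) : IntermediateField ℚ_[p] (PadicAlgCl p) :=
  IntermediateField.adjoin ℚ_[p] {ζ : PadicAlgCl p | ζ ^ (p ^ m - 1) = 1}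

section Laurent

variable {p : ℕ} [Fact p.Prime] {r n : ℕ}

/-- `Coeff_v F`, the coefficient of `t ^ v` in `F(t, z)`, a Laurent polynomial in `z`. -/
def coeffT (v : Fin r → ℤ) (F : LaurentTZ p r n) : LaurentZ p n :=
  AddMonoidAlgebra.comapDomain (Prod.mk v) (Prod.mk_right_injective v) F

/-- `σ ^ k : G(z) ↦ G(z ^ (p ^ k))`. -/
def sigma (k : ℕ) (G : LaurentZ p n) : LaurentZ p n :=
  AddMonoidAlgebra.mapDomain (fun d : Fin n → ℤ => (p ^ k : ℕ) • d) G

/-- Some coefficient of `G` is not divisible by `p`. -/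
def NonzeroModP (G : LaurentZ p n) : Prop :=
  ∃ d : Fin n → ℤ, ¬ ((p : ℤ_[p]) ∣ G.coeff d)

/-- The value `G(a) ∈ ℚ_p^{(m)}` of a Laurent polynomial `G` at a point `a` (the value is the
expected one when `a i ≠ 0` for every variable that occurs in `G` with a negative exponent). -/
def evalAt {m : ℕ} (a : Fin n → Qpm p m) (G : LaurentZ p n) : Qpm p m :=
  ∑ d ∈ G.coeff.support,
    algebraMap ℚ_[p] (Qpm p m) (G.coeff d : ℚ_[p]) * ∏ i, a i ^ (d i)

/-- The Newton polytope of `F(t, z)` with respect to the variables `t` only. -/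
def newtonPolytope (F : LaurentTZ p r n) : Set (Fin r → ℝ) :=
  convexHull ℝ ((fun (k : (Fin r → ℤ) × (Fin n → ℤ)) (i : Fin r) => (k.1 i : ℝ)) ''
    (F.coeff.support : Set ((Fin r → ℤ) × (Fin n → ℤ))))

/-- The Hasse–Witt matrix `A(M, Δ', Δ'', F) = (Coeff_{p ^ M v - u} F)`, where `Δ'` and `Δ''` are
enumerated `g`-element subsets of `ℤ^r`; `u ∈ Δ'` indexes the rows, `v ∈ Δ''` the columns. -/
def hasseWitt {g : ℕ} (M : ℕ) (D' D'' : Fin g ↪ (Fin r → ℤ)) (F : LaurentTZ p r n) :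
    Matrix (Fin g) (Fin g) (LaurentZ p n) :=
  Matrix.of fun u v => coeffT ((p ^ M : ℕ) • D'' v - D' u) F

end Laurent

section Tuples

/-- `e_{i+1} + ⋯ + e_j` (it is `0` if `j ≤ i`). The entry `e 0` is never used. -/
def esum (e : ℕ → ℕ) (i j : ℕ) : ℕ := ∑ a ∈ Finset.Ioc i j, e a

variable (p : ℕ) [Fact p.Prime] {r n g : ℕ}

/-- `(Δ, e)`-admissibility of an infinite tuple of subsets of `ℝ^r`: for all `i ≤ j`,
`(Δ_i + N_i + p^{e_{i+1}} N_{i+1} + ⋯ + p^{e_{i+1}+⋯+e_j} N_j) ∩ p^{e_{i+1}+⋯+e_{j+1}} ℤ^r`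
is contained in `p^{e_{i+1}+⋯+e_{j+1}} Δ_{j+1}`. -/
def AdmissiblePolytopes (e : ℕ → ℕ) (Δ : ℕ → Fin g ↪ (Fin r → ℤ))
    (N : ℕ → Set (Fin r → ℝ)) : Prop :=
  ∀ i j : ℕ, i ≤ j → ∀ y : Fin r → ℤ,
    (fun k => ((p : ℝ) ^ esum e i (j + 1)) * (y k : ℝ)) ∈
      Set.range (fun (u : Fin g) (k : Fin r) => (Δ i u k : ℝ)) +
        ∑ l ∈ Finset.Icc i j, ((p : ℝ) ^ esum e i l) • N l →
    y ∈ Set.range (Δ (j + 1))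

variable {p}

/-- `(Δ, e)`-admissibility of an infinite tuple of Laurent polynomials. -/
def Admissible (e : ℕ → ℕ) (Δ : ℕ → Fin g ↪ (Fin r → ℤ)) (Λ : ℕ → LaurentTZ p r n) : Prop :=
  AdmissiblePolytopes p e Δ fun l => newtonPolytope (Λ l)

/-- The Laurent polynomial `det A(e_{l+1}, Δ_l, Δ_{l+1}, Λ_l)`. -/
def basicDet (e : ℕ → ℕ) (Δ : ℕ → Fin g ↪ (Fin r → ℤ)) (Λ : ℕ → LaurentTZ p r n) (l : ℕ) :
    LaurentZ p n :=
  (hasseWitt (e (l + 1)) (Δ l) (Δ (l + 1)) (Λ l)).det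

/-- All the determinants `det A(e_{l+1}, Δ_l, Δ_{l+1}, Λ_l)` are nonzero modulo `p`. -/
def Nondegenerate (e : ℕ → ℕ) (Δ : ℕ → Fin g ↪ (Fin r → ℤ)) (Λ : ℕ → LaurentTZ p r n) : Prop :=
  ∀ l, NonzeroModP (basicDet e Δ Λ l)

/-- `W_s^{(j)} = Λ_j Λ_{j+1}^{p^{e_{j+1}}} ⋯ Λ_s^{p^{e_{j+1}+⋯+e_s}}` (it is `1` if `s < j`);
`W_s = W_s^{(0)}`. -/
def W (e : ℕ → ℕ) (Λ : ℕ → LaurentTZ p r n) (j s : ℕ) : LaurentTZ p r n :=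
  ∏ l ∈ Finset.Icc j s, Λ l ^ (p ^ esum e j l)

/-- `A(e_{j+1}+⋯+e_{s+1}, Δ_j, Δ_{s+1}, W_s^{(j)})`. -/
def matA (e : ℕ → ℕ) (Δ : ℕ → Fin g ↪ (Fin r → ℤ)) (Λ : ℕ → LaurentTZ p r n) (j s : ℕ) :
    Matrix (Fin g) (Fin g) (LaurentZ p n) :=
  hasseWitt (esum e j (s + 1)) (Δ j) (Δ (s + 1)) (W e Λ j s)

/-- `σ^{e_1}(A(e_2+⋯+e_{s+1}, Δ_1, Δ_{s+1}, W_s^{(1)}))`. -/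
def sigmaMatA (e : ℕ → ℕ) (Δ : ℕ → Fin g ↪ (Fin r → ℤ)) (Λ : ℕ → LaurentTZ p r n) (s : ℕ) :
    Matrix (Fin g) (Fin g) (LaurentZ p n) :=
  (matA e Δ Λ 1 s).map (sigma (e 1))

/-- The value at `a` of the matrix of rational functions
`A(e_1+⋯+e_{s+1}, Δ_0, Δ_{s+1}, W_s) · σ^{e_1}(A(e_2+⋯+e_{s+1}, Δ_1, Δ_{s+1}, W_s^{(1)}))⁻¹`
(meaningful when the determinant of the second matrix does not vanish at `a`). -/
def ratioAt {m : ℕ} (e : ℕ → ℕ) (Δ : ℕ → Fin g ↪ (Fin r → ℤ)) (Λ : ℕ → LaurentTZ p r n)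
    (s : ℕ) (a : Fin n → Qpm p m) : Matrix (Fin g) (Fin g) (Qpm p m) :=
  (matA e Δ Λ 0 s).map (evalAt a) * ((sigmaMatA e Δ Λ s).map (evalAt a))⁻¹

/-- The domain `𝔇^{(m)}`: the points `a` of `(ℤ_p^{(m)})ⁿ` at which the Laurent polynomials are
defined over `ℤ_p^{(m)}` (that is, `a i` is invertible in `ℤ_p^{(m)}` for each `i` such that `z_i`
occurs with a negative exponent in some `Λ_l`) and at which all the determinants
`det A(e_{l+1}, Δ_l, Δ_{l+1}, Λ_l)` have norm `1`. -/
def domainD (m : ℕ) (e : ℕ → ℕ) (Δ : ℕ → Fin g ↪ (Fin r → ℤ)) (Λ : ℕ → LaurentTZ p r n) :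
    Set (Fin n → Qpm p m) :=
  {a | (∀ i, ‖a i‖ ≤ 1) ∧
    (∀ i, (∃ l, ∃ k ∈ (Λ l).coeff.support, k.2 i < 0) → ‖a i‖ = 1) ∧
    ∀ l, ‖evalAt a (basicDet e Δ Λ l)‖ = 1}

end Tuples

end Dwork

end

/-!
Write the products `W_s^{(i)}` as `∑_{i ≤ j ≤ s} V_j φ(W_s^{(j+1)})`, where `φ` is the power of the
Frobenius lift `x ↦ x^p` that matches `j`. Since `F^(p^(k+l)) ≡ φ^k(F)^(p^l)` modulo `p^(l+1)`, the
ghost term `V_j` is divisible by `p^(j-i)`, and its Newton polytope is no larger than that of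
`W_j^{(i)}`. Admissibility makes Hasse–Witt matrices of such products factor, so the twisted
matrices `M_{i,s} = σ^{e_1+⋯+e_i}(A(e_{i+1}+⋯+e_{s+1}, Δ_i, Δ_{s+1}, W_s^{(i)}))` satisfy
`M_{i,s} = ∑_j p^(j-i) b_{i,j} M_{j+1,s}`. Wherever the `det b_{i,i}`, which are Frobenius twists of
the `d_i`, are invertible, this yields first that all `M_{i,s}` are invertible, then, by induction
on `s - i`, that the ratios `M_{i,s} M_{i+1,s}⁻¹` converge `p`-adically.

The recursion is applied in the fraction field of `𝔽_p[z^{±1}]`, for nonvanishing modulo `p`, and in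
the ring of functions on `𝔇` which on every open unit polydisc are power series with integral
coefficients. In this ring a function is invertible as soon as all its values have norm `1`, `p`
lies in the Jacobson radical, and `p`-adically convergent sequences have limits; so the limit of
the ratios is analytic and invertible.
-/

noncomputable section

namespace Dwork

section Exponents

variable {R Γ V : Type*} [CommRing R] [AddCommMonoid Γ]

/-- The exponents of `F` are mapped into `S` by `ψ`. With `ψ` the real `t`-exponent and `S` a
polytope this says that `S` contains the Newton polytope of `F`. -/
def SuppIn [AddCommMonoid V] (ψ : Γ →+ V) (F : AddMonoidAlgebra R Γ) (S : Set V) : Prop :=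
  ∀ d, F.coeff d ≠ 0 → ψ d ∈ S

namespace SuppIn

variable [AddCommMonoid V] {ψ : Γ →+ V} {F G : AddMonoidAlgebra R Γ} {S T : Set V}

theorem mono (hF : SuppIn ψ F S) (hST : S ⊆ T) : SuppIn ψ F T := fun d hd => hST (hF d hd)

theorem add (hF : SuppIn ψ F S) (hG : SuppIn ψ G S) : SuppIn ψ (F + G) S := by
  intro d hd
  by_cases h : F.coeff d = 0
  · exact hG d fun h' => hd (by simp [h, h'])
  · exact hF d h

theorem neg (hF : SuppIn ψ F S) : SuppIn ψ (-F) S := fun d hd => hF d (by simpa using hd)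

theorem sub (hF : SuppIn ψ F S) (hG : SuppIn ψ G S) : SuppIn ψ (F - G) S :=
  sub_eq_add_neg F G ▸ hF.add hG.neg

theorem zero : SuppIn ψ (0 : AddMonoidAlgebra R Γ) S := fun _ hd => absurd rfl hd

theorem sum {ι : Type*} {s : Finset ι} {f : ι → AddMonoidAlgebra R Γ}
    (hf : ∀ i ∈ s, SuppIn ψ (f i) S) : SuppIn ψ (∑ i ∈ s, f i) S :=
  Finset.sum_induction f (SuppIn ψ · S) (fun _ _ => add) zero hf

theorem single {d : Γ} (hd : ψ d ∈ S) (c : R) : SuppIn ψ (AddMonoidAlgebra.single d c) S := by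
  intro d' hd'
  by_cases h : d' = d
  · exact h ▸ hd
  · exact absurd (Finsupp.single_eq_of_ne h) hd'

theorem one : SuppIn ψ (1 : AddMonoidAlgebra R Γ) 0 := single (map_zero ψ) 1

theorem mul (hF : SuppIn ψ F S) (hG : SuppIn ψ G T) : SuppIn ψ (F * G) (S + T) := by
  classical
  intro d hd
  have h := AddMonoidAlgebra.support_coeff_mul_subset F G (Finsupp.mem_support_iff.2 hd)
  obtain ⟨x, hx, y, hy, rfl⟩ := Finset.mem_add.1 h
  exact map_add ψ x y ▸ Set.add_mem_add (hF x (Finsupp.mem_support_iff.1 hx))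
    (hG y (Finsupp.mem_support_iff.1 hy))

theorem prod {ι : Type*} {s : Finset ι} {f : ι → AddMonoidAlgebra R Γ} {T : ι → Set V}
    (hf : ∀ i ∈ s, SuppIn ψ (f i) (T i)) : SuppIn ψ (∏ i ∈ s, f i) (∑ i ∈ s, T i) := by
  classical
  induction s using Finset.induction_on with
  | empty => simpa using one
  | insert a s ha ih =>
    rw [Finset.prod_insert ha, Finset.sum_insert ha]
    exact (hf a (Finset.mem_insert_self a s)).mul
      (ih fun i hi => hf i (Finset.mem_insert_of_mem hi))

theorem of_natCast_mul [NoZeroDivisors R] [CharZero R] {c : ℕ} (hc : c ≠ 0)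
    (h : SuppIn ψ ((c : AddMonoidAlgebra R Γ) * F) S) : SuppIn ψ F S := by
  refine fun d hd => h d ?_
  rw [← nsmul_eq_mul, AddMonoidAlgebra.coeff_smul]
  simpa [hc] using hd

end SuppIn

theorem SuppIn.pow [AddCommGroup V] [Module ℝ V] {ψ : Γ →+ V} {F : AddMonoidAlgebra R Γ}
    {S : Set V} (hF : SuppIn ψ F S) (hS : Convex ℝ S) {k : ℕ} (hk : k ≠ 0) :
    SuppIn ψ (F ^ k) ((k : ℝ) • S) := by
  obtain ⟨k, rfl⟩ := Nat.exists_eq_succ_of_ne_zero hk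
  clear hk
  induction k with
  | zero => simpa using hF
  | succ k ih =>
    rw [pow_succ, Nat.cast_succ, hS.add_smul (Nat.cast_nonneg _) zero_le_one, one_smul]
    exact ih.mul hF

/-- The ring of polynomials all of whose exponents lie in the submonoid `E`. -/
def supportSubring (R : Type*) [CommRing R] (E : AddSubmonoid Γ) :
    Subring (AddMonoidAlgebra R Γ) where
  carrier := {F | SuppIn (AddMonoidHom.id Γ) F E}
  mul_mem' hF hG := (hF.mul hG).mono (by rintro _ ⟨x, hx, y, hy, rfl⟩; exact E.add_mem hx hy)
  one_mem' := SuppIn.one.mono (by simp)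
  add_mem' := SuppIn.add
  zero_mem' := SuppIn.zero
  neg_mem' := SuppIn.neg

theorem natCast_dvd_supportSubring [NoZeroDivisors R] [CharZero R] {E : AddSubmonoid Γ} {c : ℕ}
    (hc : c ≠ 0) {F : supportSubring R E} (h : (c : AddMonoidAlgebra R Γ) ∣ F) :
    (c : supportSubring R E) ∣ F := by
  obtain ⟨⟨_, hF⟩, H, rfl⟩ := F, h
  exact ⟨⟨H, SuppIn.of_natCast_mul hc hF⟩, rfl⟩

end Exponents

section Frobenius

variable {R Γ : Type*} [CommRing R] [AddCommMonoid Γ] (p : ℕ)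

/-- The Frobenius lift `x ^ d ↦ x ^ (p ^ k d)` of a polynomial ring, which fixes the
coefficients. On `LaurentZ p n` it is `sigma k`. -/
def frob (k : ℕ) : AddMonoidAlgebra R Γ →+* AddMonoidAlgebra R Γ :=
  AddMonoidAlgebra.mapDomainRingHom R (nsmulAddMonoidHom (p ^ k))

theorem frob_single (k : ℕ) (d : Γ) (c : R) :
    frob p k (AddMonoidAlgebra.single d c) = AddMonoidAlgebra.single ((p ^ k) • d) c := by
  simp [frob]

theorem frob_frob (k l : ℕ) (F : AddMonoidAlgebra R Γ) :
    frob p k (frob p l F) = frob p (k + l) F := by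
  induction F using AddMonoidAlgebra.induction_linear with
  | zero => simp
  | add F G hF hG => simp [hF, hG]
  | single d c => simp only [frob_single, smul_smul, pow_add]

theorem frob_zero (F : AddMonoidAlgebra R Γ) : frob p 0 F = F := by
  induction F using AddMonoidAlgebra.induction_linear with
  | zero => simp
  | add F G hF hG => simp [hF, hG]
  | single d c => simp [frob_single]

theorem exists_coeff_ne_zero_of_frob {k : ℕ} {F : AddMonoidAlgebra R Γ} {d : Γ}
    (h : (frob p k F).coeff d ≠ 0) : ∃ d', F.coeff d' ≠ 0 ∧ (p ^ k) • d' = d := by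
  classical
  have : d ∈ (Finsupp.mapDomain (nsmulAddMonoidHom (p ^ k)) F.coeff).support :=
    Finsupp.mem_support_iff.2 h
  obtain ⟨d', hd', rfl⟩ := Finset.mem_image.1 (Finsupp.mapDomain_support this)
  exact ⟨d', Finsupp.mem_support_iff.1 hd', rfl⟩

theorem SuppIn.frob {V : Type*} [AddCommGroup V] [Module ℝ V] {ψ : Γ →+ V}
    {F : AddMonoidAlgebra R Γ} {S : Set V} (hF : SuppIn ψ F S) (k : ℕ) :
    SuppIn ψ (frob p k F) ((p : ℝ) ^ k • S) := by
  intro d hd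
  obtain ⟨d', hd', rfl⟩ := exists_coeff_ne_zero_of_frob p hd
  refine ⟨ψ d', hF d' hd', ?_⟩
  simp only [map_nsmul, ← Nat.cast_pow, Nat.cast_smul_eq_nsmul]

theorem frob_mem_supportSubring {E : AddSubmonoid Γ} (k : ℕ) {F : AddMonoidAlgebra R Γ}
    (hF : F ∈ supportSubring R E) : frob p k F ∈ supportSubring R E := by
  intro d hd
  obtain ⟨d', hd', rfl⟩ := exists_coeff_ne_zero_of_frob p hd
  exact E.nsmul_mem (hF d' hd') _

end Frobenius

section FrobeniusCongruence

variable {p : ℕ} [Fact p.Prime] {Γ : Type*} [AddCommMonoid Γ]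

theorem prime_dvd_pow_sub_self (c : ℤ_[p]) (k : ℕ) : (p : ℤ_[p]) ∣ c ^ p ^ k - c := by
  rw [← Ideal.mem_span_singleton, ← PadicInt.maximalIdeal_eq_span_p, ← PadicInt.ker_toZMod,
    RingHom.mem_ker, map_sub, map_pow, ZMod.pow_card_pow, sub_self]

theorem prime_dvd_pow_sub_frob (k : ℕ) (F : AddMonoidAlgebra ℤ_[p] Γ) :
    (p : AddMonoidAlgebra ℤ_[p] Γ) ∣ F ^ p ^ k - frob p k F := by
  have hp : p.Prime := Fact.out
  induction F using AddMonoidAlgebra.induction_linear with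
  | zero => simp [zero_pow (pow_pos hp.pos k).ne']
  | add F G hF hG =>
    obtain ⟨r, hr⟩ := exists_add_pow_prime_pow_eq hp F G k
    have hsplit : F ^ p ^ k + G ^ p ^ k + p * F * G * r - (frob p k F + frob p k G) =
      (F ^ p ^ k - frob p k F) + (G ^ p ^ k - frob p k G) + p * (F * G * r) := by ring
    rw [hr, map_add, hsplit]
    exact dvd_add (dvd_add hF hG) (dvd_mul_right _ _)
  | single d c =>
    obtain ⟨b, hb⟩ := prime_dvd_pow_sub_self c k
    refine ⟨AddMonoidAlgebra.single ((p ^ k) • d) b, ?_⟩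
    rw [frob_single, AddMonoidAlgebra.single_pow, ← AddMonoidAlgebra.single_sub, hb,
      AddMonoidAlgebra.natCast_def, AddMonoidAlgebra.single_mul_single, zero_add]

theorem prime_pow_dvd_pow_sub_frob_pow (k l : ℕ) (F : AddMonoidAlgebra ℤ_[p] Γ) :
    (p : AddMonoidAlgebra ℤ_[p] Γ) ^ (l + 1) ∣ F ^ p ^ (k + l) - frob p k F ^ p ^ l := by
  rw [pow_add p, pow_mul]
  exact dvd_sub_pow_of_dvd_sub (prime_dvd_pow_sub_frob k F) l

end FrobeniusCongruence

section Ghosts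

theorem esum_add (e : ℕ → ℕ) {i j k : ℕ} (hij : i ≤ j) (hjk : j ≤ k) :
    esum e i j + esum e j k = esum e i k :=
  Finset.sum_Ioc_consecutive _ hij hjk

theorem esum_self (e : ℕ → ℕ) (i : ℕ) : esum e i i = 0 := by simp [esum]

theorem esum_succ_self (e : ℕ → ℕ) (i : ℕ) : esum e i (i + 1) = e (i + 1) := by simp [esum]

theorem sub_le_esum {e : ℕ → ℕ} (he : ∀ l, 0 < e (l + 1)) (i j : ℕ) : j - i ≤ esum e i j := by
  have he' : ∀ a ∈ Finset.Ioc i j, 1 ≤ e a := by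
    intro a ha
    obtain ⟨b, rfl⟩ := Nat.exists_eq_succ_of_ne_zero (Finset.mem_Ioc.1 ha).1.ne_bot
    exact he b
  simpa [esum] using Finset.card_nsmul_le_sum _ _ _ he'

variable {p : ℕ} [Fact p.Prime] {r n : ℕ} (e : ℕ → ℕ) (Λ : ℕ → LaurentTZ p r n)

theorem W_self (i : ℕ) : W e Λ i i = Λ i := by simp [W, esum_self]

theorem W_succ_self (i : ℕ) : W e Λ (i + 1) i = 1 := by simp [W]

theorem W_succ_right {i s : ℕ} (h : i ≤ s + 1) :
    W e Λ i (s + 1) = W e Λ i s * Λ (s + 1) ^ p ^ esum e i (s + 1) :=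
  Finset.prod_Icc_succ_top h _

/-- The ghost terms `V_s^{(i)}` of the products `W`, defined by recursion on `s` so that
`W_s^{(i)} = ∑_{i ≤ j ≤ s} V_j^{(i)} φ^{e_{i+1}+⋯+e_{j+1}}(W_s^{(j+1)})`, where `φ` is the
Frobenius lift. -/
def ghost (i s : ℕ) : LaurentTZ p r n :=
  W e Λ i s - ∑ j ∈ (Finset.Ico i s).attach,
    have : j.1 < s := (Finset.mem_Ico.1 j.2).2
    ghost i j.1 * frob p (esum e i (j.1 + 1)) (W e Λ (j.1 + 1) s)
termination_by s

theorem ghost_eq (i s : ℕ) :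
    ghost e Λ i s = W e Λ i s -
      ∑ j ∈ Finset.Ico i s, ghost e Λ i j * frob p (esum e i (j + 1)) (W e Λ (j + 1) s) := by
  rw [ghost, ← Finset.sum_attach (Finset.Ico i s)]

theorem ghost_self (i : ℕ) : ghost e Λ i i = Λ i := by
  rw [ghost_eq, Finset.Ico_self, Finset.sum_empty, sub_zero, W_self]

theorem W_eq_sum_ghost {i s : ℕ} (h : i ≤ s) :
    W e Λ i s =
      ∑ j ∈ Finset.Icc i s, ghost e Λ i j * frob p (esum e i (j + 1)) (W e Λ (j + 1) s) := by
  rw [← Finset.sum_Ico_add_eq_sum_Icc h, W_succ_self, map_one, mul_one, ghost_eq e Λ i s,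
    add_sub_cancel]

theorem ghost_succ {i s : ℕ} (h : i ≤ s) :
    ghost e Λ i (s + 1) = ∑ j ∈ Finset.Icc i s,
      ghost e Λ i j * frob p (esum e i (j + 1)) (W e Λ (j + 1) s) *
        (Λ (s + 1) ^ p ^ esum e i (s + 1) -
          frob p (esum e i (j + 1)) (Λ (s + 1)) ^ p ^ esum e (j + 1) (s + 1)) := by
  rw [ghost_eq, W_succ_right e Λ (by omega), W_eq_sum_ghost e Λ h, Finset.sum_mul,
    Finset.Ico_add_one_right_eq_Icc, ← Finset.sum_sub_distrib]
  refine Finset.sum_congr rfl fun j hj => ?_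
  rw [W_succ_right e Λ (Nat.succ_le_succ (Finset.mem_Icc.1 hj).2), map_mul, map_pow]
  ring

variable {e} in
theorem prime_pow_dvd_ghost (he : ∀ l, 0 < e (l + 1)) (i s : ℕ) :
    (p : LaurentTZ p r n) ^ (s - i) ∣ ghost e Λ i s := by
  induction s using Nat.strong_induction_on with
  | _ s ih =>
    rcases Nat.lt_or_ge i s with h | h
    · obtain ⟨s, rfl⟩ := Nat.exists_eq_succ_of_ne_zero h.ne_bot
      rw [Nat.succ_eq_add_one, ghost_succ e Λ (by omega)]
      refine Finset.dvd_sum fun j hj => ?_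
      obtain ⟨hij, hjs⟩ := Finset.mem_Icc.1 hj
      have hghost := ih j (by omega)
      have hfrob := prime_pow_dvd_pow_sub_frob_pow (esum e i (j + 1)) (esum e (j + 1) (s + 1))
        (Λ (s + 1))
      rw [esum_add e (by omega) (by omega)] at hfrob
      have hexp : s + 1 - i ≤ j - i + (esum e (j + 1) (s + 1) + 1) := by
        have := sub_le_esum he (j + 1) (s + 1)
        omega
      exact (pow_dvd_pow _ hexp).trans
        ((pow_add _ _ _).dvd.trans (mul_dvd_mul (hghost.mul_right _) hfrob))
    · rw [Nat.sub_eq_zero_of_le h, pow_zero]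
      exact one_dvd _

/-- The exponent of `t` as a real vector, which places Newton polytopes in `ℝ^r`. -/
def tExp (r n : ℕ) : (Fin r → ℤ) × (Fin n → ℤ) →+ (Fin r → ℝ) where
  toFun k i := (k.1 i : ℝ)
  map_zero' := by ext; simp
  map_add' := by intros; ext; simp

theorem suppIn_newtonPolytope (F : LaurentTZ p r n) : SuppIn (tExp r n) F (newtonPolytope F) :=
  fun d hd => subset_convexHull ℝ _ ⟨d, Finsupp.mem_support_iff.2 hd, rfl⟩

theorem suppIn_W (i s : ℕ) :
    SuppIn (tExp r n) (W e Λ i s)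
      (∑ l ∈ Finset.Icc i s, ((p : ℝ) ^ esum e i l) • newtonPolytope (Λ l)) := by
  refine SuppIn.prod fun l _ => ?_
  rw [← Nat.cast_pow]
  exact (suppIn_newtonPolytope (Λ l)).pow (convex_convexHull ℝ _)
    (pow_ne_zero _ (Fact.out : p.Prime).ne_zero)

theorem suppIn_ghost (i s : ℕ) :
    SuppIn (tExp r n) (ghost e Λ i s)
      (∑ l ∈ Finset.Icc i s, ((p : ℝ) ^ esum e i l) • newtonPolytope (Λ l)) := by
  induction s using Nat.strong_induction_on with
  | _ s ih =>
    rw [ghost_eq]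
    refine (suppIn_W e Λ i s).sub (SuppIn.sum fun j hj => ?_)
    obtain ⟨hij, hjs⟩ := Finset.mem_Ico.1 hj
    have hsplit : ∑ l ∈ Finset.Icc i s, ((p : ℝ) ^ esum e i l) • newtonPolytope (Λ l) =
        ∑ l ∈ Finset.Icc i j, ((p : ℝ) ^ esum e i l) • newtonPolytope (Λ l) +
          (p : ℝ) ^ esum e i (j + 1) • ∑ l ∈ Finset.Icc (j + 1) s,
            ((p : ℝ) ^ esum e (j + 1) l) • newtonPolytope (Λ l) := by
      rw [Finset.smul_sum, ← Finset.Ico_add_one_right_eq_Icc, ← Finset.Ico_add_one_right_eq_Icc,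
        ← Finset.Ico_add_one_right_eq_Icc,
        ← Finset.sum_Ico_consecutive _ (show i ≤ j + 1 by omega) (show j + 1 ≤ s + 1 by omega)]
      refine congrArg _ (Finset.sum_congr rfl fun l hl => ?_)
      rw [smul_smul, ← pow_add, esum_add e (by omega) (Finset.mem_Ico.1 hl).1]
    rw [hsplit]
    exact (ih j hjs).mul ((suppIn_W e Λ (j + 1) s).frob p (esum e i (j + 1)))

variable {Λ} {E : AddSubmonoid ((Fin r → ℤ) × (Fin n → ℤ))}

theorem W_mem_supportSubring (hΛ : ∀ l, Λ l ∈ supportSubring ℤ_[p] E) (i s : ℕ) :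
    W e Λ i s ∈ supportSubring ℤ_[p] E :=
  Subring.prod_mem _ fun l _ => Subring.pow_mem _ (hΛ l) _

theorem ghost_mem_supportSubring (hΛ : ∀ l, Λ l ∈ supportSubring ℤ_[p] E) (i s : ℕ) :
    ghost e Λ i s ∈ supportSubring ℤ_[p] E := by
  induction s using Nat.strong_induction_on with
  | _ s ih =>
    rw [ghost_eq]
    exact Subring.sub_mem _ (W_mem_supportSubring e hΛ i s) (Subring.sum_mem _ fun j hj =>
      Subring.mul_mem _ (ih j (Finset.mem_Ico.1 hj).2)
        (frob_mem_supportSubring p _ (W_mem_supportSubring e hΛ _ _)))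

end Ghosts

section HasseWitt

variable {p : ℕ} [Fact p.Prime] {r n g : ℕ}

theorem coeffT_add (v : Fin r → ℤ) (F G : LaurentTZ p r n) :
    coeffT v (F + G) = coeffT v F + coeffT v G :=
  AddMonoidAlgebra.comapDomain_add _ _ _ _

theorem coeffT_zero (v : Fin r → ℤ) : coeffT v (0 : LaurentTZ p r n) = 0 :=
  AddMonoidAlgebra.comapDomain_zero _ _

theorem coeffT_single (v : Fin r → ℤ) (k : (Fin r → ℤ) × (Fin n → ℤ)) (c : ℤ_[p]) :
    coeffT v (AddMonoidAlgebra.single k c) =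
      if k.1 = v then AddMonoidAlgebra.single k.2 c else 0 := by
  obtain ⟨x, d⟩ := k
  split_ifs with h
  · subst h
    exact AddMonoidAlgebra.comapDomain_single_map _ _ _ _
  · exact AddMonoidAlgebra.ext (Finsupp.ext fun d' =>
      Finsupp.single_eq_of_ne fun h' => h (congrArg Prod.fst h').symm)

theorem coeffT_single_mul (v : Fin r → ℤ) (k : (Fin r → ℤ) × (Fin n → ℤ)) (c : ℤ_[p])
    (F : LaurentTZ p r n) :
    coeffT v (AddMonoidAlgebra.single k c * F) =
      AddMonoidAlgebra.single k.2 c * coeffT (v - k.1) F := by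
  refine AddMonoidAlgebra.ext (Finsupp.ext fun d => ?_)
  change (AddMonoidAlgebra.single k c * F).coeff (v, d) = _
  rw [AddMonoidAlgebra.coeff_single_mul_apply, AddMonoidAlgebra.coeff_single_mul_apply,
    sub_eq_neg_add]
  rfl

theorem coeffT_nsmul_frob (M : ℕ) (y : Fin r → ℤ) (F : LaurentTZ p r n) :
    coeffT (p ^ M • y) (frob p M F) = frob p M (coeffT y F) := by
  have hinj := smul_right_injective (Fin r → ℤ) (pow_ne_zero M (Fact.out : p.Prime).ne_zero)
  induction F using AddMonoidAlgebra.induction_linear with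
  | zero => simp only [map_zero, coeffT_zero]
  | add F G hF hG => simp only [map_add, coeffT_add, hF, hG]
  | single k c =>
    simp only [frob_single, coeffT_single, Prod.smul_fst, Prod.smul_snd, hinj.eq_iff,
      apply_ite (frob p M), map_zero]

theorem coeffT_frob_eq_zero {M : ℕ} {v : Fin r → ℤ} (hv : ∀ y, v ≠ p ^ M • y)
    (F : LaurentTZ p r n) : coeffT v (frob p M F) = 0 := by
  refine AddMonoidAlgebra.ext (Finsupp.ext fun d => ?_)
  by_contra hd
  obtain ⟨k, -, hk⟩ := exists_coeff_ne_zero_of_frob p hd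
  exact hv k.1 (congrArg Prod.fst hk).symm

theorem hasseWitt_add (M : ℕ) (D' D'' : Fin g ↪ (Fin r → ℤ)) (F G : LaurentTZ p r n) :
    hasseWitt M D' D'' (F + G) = hasseWitt M D' D'' F + hasseWitt M D' D'' G :=
  Matrix.ext fun _ _ => coeffT_add _ _ _

theorem hasseWitt_sum {ι : Type*} (s : Finset ι) (f : ι → LaurentTZ p r n) (M : ℕ)
    (D' D'' : Fin g ↪ (Fin r → ℤ)) :
    hasseWitt M D' D'' (∑ i ∈ s, f i) = ∑ i ∈ s, hasseWitt M D' D'' (f i) :=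
  map_sum (AddMonoidHom.mk' (hasseWitt M D' D'') (hasseWitt_add M D' D'')) f s

theorem hasseWitt_nsmul (M k : ℕ) (D' D'' : Fin g ↪ (Fin r → ℤ)) (F : LaurentTZ p r n) :
    hasseWitt M D' D'' (k • F) = k • hasseWitt M D' D'' F :=
  map_nsmul (AddMonoidHom.mk' (hasseWitt M D' D'') (hasseWitt_add M D' D'')) _ _

theorem hasseWitt_one (D : Fin g ↪ (Fin r → ℤ)) :
    hasseWitt 0 D D (1 : LaurentTZ p r n) = 1 := by
  ext1 u v
  have huv : 0 = D v - D u ↔ u = v := by rw [eq_comm, sub_eq_zero, D.injective.eq_iff, eq_comm]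
  simp only [hasseWitt, Matrix.of_apply, Matrix.one_apply, AddMonoidAlgebra.one_def, coeffT_single,
    pow_zero, one_smul, Prod.fst_zero, Prod.snd_zero, huv]

theorem hasseWitt_mem_supportSubring {E : AddSubmonoid (Fin n → ℤ)} {F : LaurentTZ p r n}
    (hF : F ∈ supportSubring ℤ_[p] (E.comap (AddMonoidHom.snd (Fin r → ℤ) (Fin n → ℤ)))) (M : ℕ)
    (D' D'' : Fin g ↪ (Fin r → ℤ)) (u v : Fin g) :
    hasseWitt M D' D'' F u v ∈ supportSubring ℤ_[p] E :=
  fun d hd => hF (_, d) hd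

theorem hasseWitt_single_mul_frob {M M' : ℕ} {D' D D'' : Fin g ↪ (Fin r → ℤ)}
    {k : (Fin r → ℤ) × (Fin n → ℤ)}
    (hk : ∀ u y, k.1 + D' u = p ^ M • y → y ∈ Set.range D) (c : ℤ_[p]) (G : LaurentTZ p r n) :
    hasseWitt (M + M') D' D'' (AddMonoidAlgebra.single k c * frob p M G) =
      hasseWitt M D' D (AddMonoidAlgebra.single k c) * (hasseWitt M' D D'' G).map (frob p M) := by
  ext1 u v
  have hcol : ∀ w, k.1 = p ^ M • D w - D' u ↔ k.1 + D' u = p ^ M • D w := fun w =>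
    eq_sub_iff_add_eq
  simp only [Matrix.mul_apply, Matrix.map_apply, hasseWitt, Matrix.of_apply, coeffT_single_mul,
    coeffT_single, hcol, sub_sub, add_comm (D' u)]
  by_cases h : ∃ y, k.1 + D' u = p ^ M • y
  · obtain ⟨y, hy⟩ := h
    obtain ⟨w, rfl⟩ := hk u y hy
    have hinj := smul_right_injective (Fin r → ℤ) (pow_ne_zero M (Fact.out : p.Prime).ne_zero)
    have hcoeff := coeffT_nsmul_frob M (p ^ M' • D'' v - D w) G
    simp only [hy, hinj.eq_iff, D.injective.eq_iff, ite_mul, zero_mul, Finset.sum_ite_eq,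
      Finset.mem_univ, if_true]
    rw [← hcoeff, smul_sub, pow_add, mul_smul]
  · push Not at h
    rw [coeffT_frob_eq_zero, mul_zero]
    · simp only [h, if_false, zero_mul, Finset.sum_const_zero]
    · intro y hy
      refine h (p ^ M' • D'' v - y) ?_
      rw [smul_sub, smul_smul, ← pow_add, ← hy, sub_sub_cancel]

theorem hasseWitt_mul_frob {M M' : ℕ} {D' D D'' : Fin g ↪ (Fin r → ℤ)} {F : LaurentTZ p r n}
    (hF : ∀ k, F.coeff k ≠ 0 → ∀ u y, k.1 + D' u = p ^ M • y → y ∈ Set.range D)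
    (G : LaurentTZ p r n) :
    hasseWitt (M + M') D' D'' (F * frob p M G) =
      hasseWitt M D' D F * (hasseWitt M' D D'' G).map (frob p M) := by
  rw [← AddMonoidAlgebra.sum_coeff_single F, Finsupp.sum, Finset.sum_mul, hasseWitt_sum,
    hasseWitt_sum, Finset.sum_mul]
  exact Finset.sum_congr rfl fun k hk =>
    hasseWitt_single_mul_frob (hF k (Finsupp.mem_support_iff.1 hk)) _ G

variable {e : ℕ → ℕ} {Δ : ℕ → Fin g ↪ (Fin r → ℤ)} {Λ : ℕ → LaurentTZ p r n}

theorem matA_succ_self (s : ℕ) : matA e Δ Λ (s + 1) s = 1 := by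
  rw [matA, esum_self, W_succ_self, hasseWitt_one]

theorem Admissible.mem_range_of_ghost_ne_zero (hadm : Admissible e Δ Λ) {i j : ℕ} (hij : i ≤ j)
    {k : (Fin r → ℤ) × (Fin n → ℤ)} (hk : (ghost e Λ i j).coeff k ≠ 0) {u : Fin g}
    {y : Fin r → ℤ} (hy : k.1 + Δ i u = p ^ esum e i (j + 1) • y) :
    y ∈ Set.range (Δ (j + 1)) := by
  refine hadm i j hij y (Set.mem_add.2 ⟨_, ⟨u, rfl⟩, _, suppIn_ghost e Λ i j k hk, ?_⟩)
  ext a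
  have hya := congrArg (Int.cast : ℤ → ℝ) (congrFun hy a)
  simp only [Pi.add_apply, Pi.smul_apply, nsmul_eq_mul, Int.cast_add, Int.cast_mul, Nat.cast_pow,
    Int.cast_pow, Int.cast_natCast] at hya
  rw [← hya, Pi.add_apply, add_comm]
  rfl

theorem matA_eq_sum_ghost (hadm : Admissible e Δ Λ) {i s : ℕ} (his : i ≤ s) :
    matA e Δ Λ i s = ∑ j ∈ Finset.Icc i s,
      hasseWitt (esum e i (j + 1)) (Δ i) (Δ (j + 1)) (ghost e Λ i j) *
        (matA e Δ Λ (j + 1) s).map (frob p (esum e i (j + 1))) := by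
  rw [matA, W_eq_sum_ghost e Λ his, hasseWitt_sum]
  refine Finset.sum_congr rfl fun j hj => ?_
  obtain ⟨hij, hjs⟩ := Finset.mem_Icc.1 hj
  rw [← esum_add e (show i ≤ j + 1 by omega) (show j + 1 ≤ s + 1 by omega)]
  exact hasseWitt_mul_frob (fun k hk u y => hadm.mem_range_of_ghost_ne_zero hij hk) _

end HasseWitt

section DworkSystems

section Divisibility

variable {R : Type*} [Ring R] {c : ℕ}

theorem natCast_dvd_mul_left {x : R} (h : (c : R) ∣ x) (y : R) : (c : R) ∣ y * x := by
  obtain ⟨z, rfl⟩ := h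
  exact ⟨y * z, by rw [← mul_assoc, ← mul_assoc, (Nat.cast_commute c y).eq]⟩

theorem natCast_dvd_mul_sub_mul {x x' y y' : R} (hx : (c : R) ∣ x - x') (hy : (c : R) ∣ y - y') :
    (c : R) ∣ x * y - x' * y' := by
  have hsplit : x * y - x' * y' = (x - x') * y + x' * (y - y') := by noncomm_ring
  rw [hsplit]
  exact dvd_add (hx.mul_right y) (natCast_dvd_mul_left hy x')

theorem natCast_dvd_inv_sub_inv {x y : Rˣ} (h : (c : R) ∣ (x : R) - y) :
    (c : R) ∣ ((x⁻¹ : Rˣ) : R) - (y⁻¹ : Rˣ) := by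
  have hsplit : ((x⁻¹ : Rˣ) : R) - (y⁻¹ : Rˣ) = -((x⁻¹ : Rˣ) * (((x : R) - y) * (y⁻¹ : Rˣ))) := by
    rw [sub_mul, Units.mul_inv, mul_sub, ← mul_assoc, Units.inv_mul, one_mul, mul_one, neg_sub]
  rw [hsplit, dvd_neg]
  exact natCast_dvd_mul_left (h.mul_right _) _

theorem natCast_pow_dvd_mul_inv_sub {p : ℕ} {x y : ℕ → Rˣ} {i s : ℕ}
    (h : ∀ j, i < j → j ≤ s → ((p ^ (s + 1 - j) : ℕ) : R) ∣
      ((x j * (x (j + 1))⁻¹ : Rˣ) : R) - (y j * (y (j + 1))⁻¹ : Rˣ)) {j : ℕ} (hij : i ≤ j)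
    (hjs : j ≤ s) :
    ((p ^ (s + 1 - j) : ℕ) : R) ∣
      ((x (j + 1) * (x (i + 1))⁻¹ : Rˣ) : R) - (y (j + 1) * (y (i + 1))⁻¹ : Rˣ) := by
  induction j, hij using Nat.le_induction with
  | base => simp
  | succ j hij ih =>
    have hstep := natCast_dvd_inv_sub_inv (h (j + 1) (by omega) hjs)
    have hprev := (Nat.cast_dvd_cast (α := R) (pow_dvd_pow p
      (show s + 1 - (j + 1) ≤ s + 1 - j by omega))).trans (ih (by omega))
    simpa [← Units.val_mul, mul_assoc] using natCast_dvd_mul_sub_mul hstep hprev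

end Divisibility

/-- Families `M i s` with `M (s + 1) s = 1` that satisfy the triangular relations
`M i s = ∑_{i ≤ j ≤ s} p ^ (j - i) b i j M (j + 1) s`. The Frobenius twists of the Hasse–Witt
matrices of the products `W_s^{(i)}` are of this kind. -/
structure IsDworkSystem {R : Type*} [Ring R] (p : ℕ) (M b : ℕ → ℕ → R) : Prop where
  succ_self : ∀ s, M (s + 1) s = 1
  eq_sum : ∀ {i s}, i ≤ s →
    M i s = ∑ j ∈ Finset.Icc i s, (p ^ (j - i)) • (b i j * M (j + 1) s)

namespace IsDworkSystem

variable {R R' : Type*} [Ring R] [Ring R'] {p : ℕ} {M b : ℕ → ℕ → R}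

theorem map (h : IsDworkSystem p M b) (f : R →+* R') :
    IsDworkSystem p (fun i s => f (M i s)) fun i j => f (b i j) where
  succ_self s := by rw [h.succ_self, map_one]
  eq_sum his := by simp only [h.eq_sum his, map_sum, map_nsmul, map_mul]

theorem of_map {f : R →+* R'} (hf : Function.Injective f)
    (h : IsDworkSystem p (fun i s => f (M i s)) fun i j => f (b i j)) : IsDworkSystem p M b where
  succ_self s := hf (by rw [h.succ_self, map_one])
  eq_sum his := hf (by simp only [h.eq_sum his, map_sum, map_nsmul, map_mul])

theorem natCast_dvd_sub_mul (h : IsDworkSystem p M b) {i s : ℕ} (his : i ≤ s) :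
    (p : R) ∣ M i s - b i i * M (i + 1) s := by
  rw [h.eq_sum his, ← Finset.add_sum_Ioc_eq_sum_Icc his, Nat.sub_self, pow_zero, one_smul,
    add_sub_cancel_left]
  refine Finset.dvd_sum fun j hj => ?_
  rw [nsmul_eq_mul]
  exact (Nat.cast_dvd_cast (dvd_pow_self p
    (Nat.sub_ne_zero_of_lt (Finset.mem_Ioc.1 hj).1))).mul_right _

theorem natCast_pow_dvd_ratio_sub (h : IsDworkSystem p M b) {u : ℕ → ℕ → Rˣ}
    (hu : ∀ i s, i ≤ s + 1 → (u i s : R) = M i s) {i s : ℕ} (his : i ≤ s) :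
    ((p ^ (s + 1 - i) : ℕ) : R) ∣
      ((u i (s + 1) * (u (i + 1) (s + 1))⁻¹ : Rˣ) : R) - (u i s * (u (i + 1) s)⁻¹ : Rˣ) := by
  induction d : s - i using Nat.strong_induction_on generalizing i with
  | _ d ih =>
    have hsum : ∀ t, i ≤ t → ((u i t * (u (i + 1) t)⁻¹ : Rˣ) : R) = ∑ j ∈ Finset.Icc i t,
        ((p ^ (j - i) : ℕ) : R) * (b i j * (u (j + 1) t * (u (i + 1) t)⁻¹ : Rˣ)) := by
      intro t hit
      rw [Units.val_mul, hu i t (by omega), h.eq_sum hit, Finset.sum_mul]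
      refine Finset.sum_congr rfl fun j hj => ?_
      rw [← hu (j + 1) t (by have := Finset.mem_Icc.1 hj; omega), nsmul_eq_mul, Units.val_mul]
      simp only [mul_assoc]
    rw [hsum _ his, hsum _ (by omega), Finset.sum_Icc_succ_top (by omega), add_sub_right_comm,
      ← Finset.sum_sub_distrib]
    refine dvd_add (Finset.dvd_sum fun j hj => ?_) (dvd_mul_right _ _)
    obtain ⟨hij, hjs⟩ := Finset.mem_Icc.1 hj
    have htail := natCast_dvd_mul_left (natCast_pow_dvd_mul_inv_sub
      (x := fun j => u j (s + 1)) (y := fun j => u j s)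
      (fun k hik hks => ih (s - k) (by omega) hks rfl) hij hjs) (b i j)
    rw [← mul_sub, ← mul_sub, show s + 1 - i = j - i + (s + 1 - j) by omega, pow_add, Nat.cast_mul]
    exact mul_dvd_mul_left _ htail

end IsDworkSystem

section JacobsonRadical

variable {A ι : Type*} [CommRing A] [Fintype ι] [DecidableEq ι] {c : ℕ}

theorem natCast_dvd_matrix_iff {X : Matrix ι ι A} :
    (c : Matrix ι ι A) ∣ X ↔ ∀ i j, (c : A) ∣ X i j := by
  refine ⟨?_, fun h => ?_⟩
  · rintro ⟨Y, rfl⟩ i j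
    rw [← nsmul_eq_mul, Matrix.smul_apply, nsmul_eq_mul]
    exact dvd_mul_right _ _
  · choose Y hY using h
    refine ⟨Matrix.of Y, Matrix.ext fun i j => ?_⟩
    rw [← nsmul_eq_mul, Matrix.smul_apply, nsmul_eq_mul, hY, Matrix.of_apply]

theorem isUnit_of_natCast_dvd_sub (hc : (c : A) ∈ Ideal.jacobson (⊥ : Ideal A)) {x y : A}
    (h : (c : A) ∣ x - y) (hy : IsUnit y) : IsUnit x := by
  let q := Ideal.Quotient.mk (Ideal.span {(c : A)})
  have : IsLocalHom q :=
    isLocalHom_of_le_jacobson_bot _ ((Ideal.span_singleton_le_iff_mem _).2 hc)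
  have hq : q x = q y := Ideal.Quotient.eq.2 (Ideal.mem_span_singleton.2 h)
  exact .of_map q _ (hq ▸ hy.map q)

theorem dvd_det_sub_det {a : A} {X Y : Matrix ι ι A} (h : ∀ i j, a ∣ X i j - Y i j) :
    a ∣ X.det - Y.det := by
  rw [← Ideal.mem_span_singleton, ← Ideal.Quotient.eq, RingHom.map_det, RingHom.map_det]
  exact congrArg _ (Matrix.ext fun i j =>
    Ideal.Quotient.eq.2 (Ideal.mem_span_singleton.2 (h i j)))

theorem isUnit_matrix_of_natCast_dvd_sub (hc : (c : A) ∈ Ideal.jacobson (⊥ : Ideal A))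
    {X Y : Matrix ι ι A} (h : (c : Matrix ι ι A) ∣ X - Y) (hY : IsUnit Y) : IsUnit X := by
  rw [Matrix.isUnit_iff_isUnit_det] at hY ⊢
  exact isUnit_of_natCast_dvd_sub hc (dvd_det_sub_det (natCast_dvd_matrix_iff.1 h)) hY

end JacobsonRadical

theorem IsDworkSystem.isUnit_matrix {A ι : Type*} [CommRing A] [Fintype ι] [DecidableEq ι] {p : ℕ}
    {M b : ℕ → ℕ → Matrix ι ι A} (h : IsDworkSystem p M b)
    (hp : (p : A) ∈ Ideal.jacobson (⊥ : Ideal A)) (hb : ∀ i, IsUnit (b i i)) {i s : ℕ}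
    (his : i ≤ s + 1) : IsUnit (M i s) := by
  induction his using Nat.decreasingInduction with
  | self => exact h.succ_self s ▸ isUnit_one
  | of_succ i hi ih =>
    exact isUnit_matrix_of_natCast_dvd_sub hp (h.natCast_dvd_sub_mul (Nat.lt_succ_iff.1 hi))
      ((hb i).mul ih)

end DworkSystems

section SupportedMatrices

variable {p : ℕ} [Fact p.Prime] {r n g : ℕ} {E : AddSubmonoid (Fin n → ℤ)}

/-- The Frobenius lift on the Laurent polynomials with exponents in `E`. -/
def frobOn (E : AddSubmonoid (Fin n → ℤ)) (k : ℕ) :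
    supportSubring ℤ_[p] E →+* supportSubring ℤ_[p] E :=
  (frob p k).restrict _ _ fun _ => frob_mem_supportSubring p k

theorem isUnit_map_frobOn {A : Type*} [CommRing A] (φ : supportSubring ℤ_[p] E →+* A)
    (hp : (p : A) ∈ Ideal.jacobson (⊥ : Ideal A)) {F : supportSubring ℤ_[p] E}
    (hF : IsUnit (φ F)) (k : ℕ) : IsUnit (φ (frobOn E k F)) := by
  refine isUnit_of_natCast_dvd_sub hp ?_ (map_pow φ F (p ^ k) ▸ hF.pow (p ^ k))
  rw [dvd_sub_comm, ← map_sub, ← map_natCast φ]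
  exact map_dvd φ
    (natCast_dvd_supportSubring (Fact.out : p.Prime).ne_zero (prime_dvd_pow_sub_frob k _))

/-- The Hasse–Witt matrix over the ring of Laurent polynomials with exponents in `E`. -/
def hasseWittOn {F : LaurentTZ p r n}
    (hF : F ∈ supportSubring ℤ_[p] (E.comap (AddMonoidHom.snd (Fin r → ℤ) (Fin n → ℤ)))) (M : ℕ)
    (D' D'' : Fin g ↪ (Fin r → ℤ)) : Matrix (Fin g) (Fin g) (supportSubring ℤ_[p] E) :=
  Matrix.of fun u v =>
    ⟨hasseWitt M D' D'' F u v, hasseWitt_mem_supportSubring hF M D' D'' u v⟩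

theorem coe_det (X : Matrix (Fin g) (Fin g) (supportSubring ℤ_[p] E)) :
    (X.det : LaurentZ p n) = (X.map Subtype.val).det := by
  rw [← Subring.subtype_apply, RingHom.map_det]
  rfl

variable {e : ℕ → ℕ} {Δ : ℕ → Fin g ↪ (Fin r → ℤ)} {Λ : ℕ → LaurentTZ p r n}

theorem isDworkSystem_mapMatrix_frob_matA (hadm : Admissible e Δ Λ) {H : ℕ → ℕ → LaurentTZ p r n}
    (hH : ∀ i j, ghost e Λ i j = (p : LaurentTZ p r n) ^ (j - i) * H i j) :
    IsDworkSystem p (fun i s => (frob p (esum e 0 i)).mapMatrix (matA e Δ Λ i s))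
      fun i j => (frob p (esum e 0 i)).mapMatrix
        (hasseWitt (esum e i (j + 1)) (Δ i) (Δ (j + 1)) (H i j)) where
  succ_self s := by rw [matA_succ_self, map_one]
  eq_sum {i s} his := by
    rw [matA_eq_sum_ghost hadm his, map_sum]
    refine Finset.sum_congr rfl fun j hj => ?_
    obtain ⟨hij, -⟩ := Finset.mem_Icc.1 hj
    rw [hH, ← Nat.cast_pow, ← nsmul_eq_mul, hasseWitt_nsmul, smul_mul_assoc, map_nsmul, map_mul]
    congr 2
    ext1 u v
    simp only [RingHom.mapMatrix_apply, Matrix.map_apply, frob_frob,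
      esum_add e (Nat.zero_le i) (show i ≤ j + 1 by omega)]

variable (hΛ : ∀ l, Λ l ∈ supportSubring ℤ_[p] (E.comap (AddMonoidHom.snd (Fin r → ℤ) (Fin n → ℤ))))

/-- The twist `σ^{e_1+⋯+e_i}(A(e_{i+1}+⋯+e_{s+1}, Δ_i, Δ_{s+1}, W_s^{(i)}))`, over the ring of
Laurent polynomials with exponents in `E`. -/
def twistedMatA (e : ℕ → ℕ) (Δ : ℕ → Fin g ↪ (Fin r → ℤ)) (i s : ℕ) :
    Matrix (Fin g) (Fin g) (supportSubring ℤ_[p] E) :=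
  (frobOn E (esum e 0 i)).mapMatrix
    (hasseWittOn (W_mem_supportSubring e hΛ i s) (esum e i (s + 1)) (Δ i) (Δ (s + 1)))

theorem coe_twistedMatA_zero (s : ℕ) (u v : Fin g) :
    (twistedMatA hΛ e Δ 0 s u v : LaurentZ p n) = matA e Δ Λ 0 s u v := by
  change frob p (esum e 0 0) (matA e Δ Λ 0 s u v) = _
  rw [esum_self, frob_zero]

theorem coe_twistedMatA_one (s : ℕ) (u v : Fin g) :
    (twistedMatA hΛ e Δ 1 s u v : LaurentZ p n) = sigmaMatA e Δ Λ s u v := by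
  change frob p (esum e 0 1) (matA e Δ Λ 1 s u v) = _
  rw [esum_succ_self, zero_add]
  rfl

theorem exists_isDworkSystem_twistedMatA (he : ∀ l, 0 < e (l + 1)) (hadm : Admissible e Δ Λ) :
    ∃ b, IsDworkSystem p (twistedMatA hΛ e Δ) b ∧ ∀ i, b i i =
      (frobOn E (esum e 0 i)).mapMatrix (hasseWittOn (hΛ i) (e (i + 1)) (Δ i) (Δ (i + 1))) := by
  have hp : p ≠ 0 := (Fact.out : p.Prime).ne_zero
  choose H hH using prime_pow_dvd_ghost Λ he
  have hH_mem : ∀ i j,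
      H i j ∈ supportSubring ℤ_[p] (E.comap (AddMonoidHom.snd (Fin r → ℤ) (Fin n → ℤ))) := by
    intro i j
    refine SuppIn.of_natCast_mul (pow_ne_zero (j - i) hp) ?_
    rw [Nat.cast_pow, ← hH]
    exact ghost_mem_supportSubring e hΛ i j
  have hinj : Function.Injective ((supportSubring ℤ_[p] E).subtype.mapMatrix (m := Fin g)) :=
    Matrix.map_injective Subtype.val_injective
  refine ⟨fun i j => (frobOn E (esum e 0 i)).mapMatrix
      (hasseWittOn (hH_mem i j) (esum e i (j + 1)) (Δ i) (Δ (j + 1))),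
    .of_map hinj (isDworkSystem_mapMatrix_frob_matA hadm hH), fun i => ?_⟩
  have hself : H i i = Λ i := by
    have h := hH i i
    rwa [ghost_self, Nat.sub_self, pow_zero, one_mul, eq_comm] at h
  simp only [esum_succ_self]
  congr 2

theorem isUnit_mapMatrix_twistedMatA (he : ∀ l, 0 < e (l + 1)) (hadm : Admissible e Δ Λ)
    {A : Type*} [CommRing A] (φ : supportSubring ℤ_[p] E →+* A)
    (hp : (p : A) ∈ Ideal.jacobson (⊥ : Ideal A))
    (hd : ∀ l, IsUnit (φ (hasseWittOn (hΛ l) (e (l + 1)) (Δ l) (Δ (l + 1))).det)) {i s : ℕ}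
    (his : i ≤ s + 1) : IsUnit (φ.mapMatrix (twistedMatA hΛ e Δ i s)) := by
  obtain ⟨b, hsys, hb⟩ := exists_isDworkSystem_twistedMatA (Δ := Δ) hΛ he hadm
  refine (hsys.map φ.mapMatrix).isUnit_matrix hp (fun l => ?_) his
  rw [hb, Matrix.isUnit_iff_isUnit_det, ← RingHom.map_det, ← RingHom.map_det]
  exact isUnit_map_frobOn φ hp (hd l) _

theorem det_sigmaMatA (s : ℕ) :
    (sigmaMatA e Δ Λ s).det = ((twistedMatA hΛ e Δ 1 s).det : LaurentZ p n) := by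
  rw [coe_det]
  exact congrArg _ (Matrix.ext fun u v => (coe_twistedMatA_one hΛ s u v).symm)

end SupportedMatrices

section NonzeroModP

variable {p : ℕ} [Fact p.Prime] {r n g : ℕ}

theorem nonzeroModP_iff (G : LaurentZ p n) :
    NonzeroModP G ↔
      AddMonoidAlgebra.mapRingHom (Fin n → ℤ) (PadicInt.toZMod (p := p)) G ≠ 0 := by
  have hcoeff : ∀ c : ℤ_[p], (p : ℤ_[p]) ∣ c ↔ PadicInt.toZMod c = 0 := fun c => by
    rw [← RingHom.mem_ker, PadicInt.ker_toZMod, PadicInt.maximalIdeal_eq_span_p,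
      Ideal.mem_span_singleton]
  rw [Ne, AddMonoidAlgebra.ext_iff, Finsupp.ext_iff, not_forall]
  exact exists_congr fun d => (hcoeff _).not

theorem nonzeroModP_det_sigmaMatA {e : ℕ → ℕ} {Δ : ℕ → Fin g ↪ (Fin r → ℤ)}
    {Λ : ℕ → LaurentTZ p r n} (he : ∀ l, 0 < e (l + 1)) (hadm : Admissible e Δ Λ)
    (hnd : Nondegenerate e Δ Λ) (s : ℕ) : NonzeroModP (sigmaMatA e Δ Λ s).det := by
  let 𝔽 := AddMonoidAlgebra (ZMod p) (Fin n → ℤ)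
  let ρ : LaurentZ p n →+* 𝔽 := AddMonoidAlgebra.mapRingHom (Fin n → ℤ) (PadicInt.toZMod (p := p))
  have hΛ : ∀ l, Λ l ∈ supportSubring ℤ_[p]
      ((⊤ : AddSubmonoid (Fin n → ℤ)).comap (AddMonoidHom.snd (Fin r → ℤ) (Fin n → ℤ))) :=
    fun _ _ _ => trivial
  let φ := ((algebraMap 𝔽 (FractionRing 𝔽)).comp ρ).comp (supportSubring ℤ_[p] ⊤).subtype
  have hφ : ∀ F, IsUnit (φ F) ↔ NonzeroModP (F : LaurentZ p n) := fun F => by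
    rw [nonzeroModP_iff, isUnit_iff_ne_zero]
    exact map_ne_zero_iff _ (IsFractionRing.injective 𝔽 (FractionRing 𝔽))
  have hp : (p : FractionRing 𝔽) = 0 := by
    rw [← map_natCast (algebraMap 𝔽 (FractionRing 𝔽)),
      ← map_natCast (algebraMap (ZMod p) 𝔽), ZMod.natCast_self, map_zero, map_zero]
  have hunit := isUnit_mapMatrix_twistedMatA (Δ := Δ) hΛ he hadm φ (hp ▸ Ideal.zero_mem _)
    (fun l => (hφ _).2 ?_) (show 1 ≤ s + 1 by omega)
  · rw [Matrix.isUnit_iff_isUnit_det, ← RingHom.map_det, hφ] at hunit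
    rwa [det_sigmaMatA hΛ]
  · rw [coe_det]
    exact hnd l

end NonzeroModP

section PowerSeriesValues

open scoped NormedField Valued MvPowerSeries.WithPiTopology

variable {K ι : Type*} [NontriviallyNormedField K] [IsUltrametricDist K] [Fintype ι]

instance isLinearTopology_integer : IsLinearTopology 𝒪[K] 𝒪[K] := by
  let ballIdeal (ε : {ε : ℝ // 0 < ε}) : Ideal 𝒪[K] :=
    { carrier := Metric.closedBall 0 ε
      add_mem' := (IsUltrametricDist.closedBall_openAddSubgroup 𝒪[K] ε.2).add_mem
      zero_mem' := Metric.mem_closedBall_self ε.2.le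
      smul_mem' := fun r x hx => by
        rw [mem_closedBall_zero_iff, norm_smul] at *
        exact (mul_le_of_le_one_left (norm_nonneg x) (Valued.integer.norm_le_one r)).trans hx }
  refine IsLinearTopology.mk_of_hasBasis 𝒪[K] (p := fun _ => True) (s := ballIdeal)
    ⟨fun t => Metric.nhds_basis_closedBall.mem_iff.trans ?_⟩
  exact ⟨fun ⟨ε, hε, h⟩ => ⟨⟨ε, hε⟩, trivial, h⟩, fun ⟨ε, _, h⟩ => ⟨ε, ε.2, h⟩⟩

instance completeSpace_integer [CompleteSpace K] : CompleteSpace 𝒪[K] :=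
  (Valued.isClosed_integer K).completeSpace_coe

/-- A point of the open unit polydisc, with its coordinates regarded as integers. -/
def toInteger {w : ι → K} (hw : ‖w‖ < 1) (i : ι) : 𝒪[K] :=
  ⟨w i, Valued.integer.mem_iff.2 ((norm_le_pi_norm w i).trans hw.le)⟩

theorem hasEval_toInteger {w : ι → K} (hw : ‖w‖ < 1) : MvPowerSeries.HasEval (toInteger hw) where
  hpow i := tendsto_pow_atTop_nhds_zero_of_norm_lt_one ((norm_le_pi_norm w i).trans_lt hw)
  tendsto_zero := by simp [Filter.cofinite_eq_bot]

variable [CompleteSpace K]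

/-- The value of a power series with integral coefficients at a point of the open unit
polydisc. -/
def psEval {w : ι → K} (hw : ‖w‖ < 1) : MvPowerSeries ι 𝒪[K] →ₐ[𝒪[K]] 𝒪[K] :=
  MvPowerSeries.aeval (hasEval_toInteger hw)

theorem hasSum_psEval {w : ι → K} (hw : ‖w‖ < 1) (c : MvPowerSeries ι 𝒪[K]) :
    HasSum (fun d => ((MvPowerSeries.coeff d c : 𝒪[K]) : K) * ∏ i, w i ^ d i)
      (psEval hw c : K) := by
  refine ((MvPowerSeries.hasSum_aeval (hasEval_toInteger hw) c).map (Subring.subtype _)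
    continuous_subtype_val).congr_fun fun d => ?_
  rw [Function.comp_apply, Finsupp.prod_fintype _ _ fun _ => pow_zero _, smul_eq_mul, map_mul,
    map_prod]
  rfl

theorem psEval_X {w : ι → K} (hw : ‖w‖ < 1) (i : ι) :
    (psEval hw (MvPowerSeries.X i) : K) = w i := by
  rw [psEval, ← MvPolynomial.coe_X, MvPowerSeries.aeval_coe, MvPolynomial.aeval_X, toInteger]

theorem psEval_zero (h : ‖(0 : ι → K)‖ < 1) (c : MvPowerSeries ι 𝒪[K]) :
    psEval h c = MvPowerSeries.constantCoeff c := by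
  refine (MvPowerSeries.aeval_eq_sum _ c).trans ((tsum_eq_single 0 fun d hd => ?_).trans ?_)
  · obtain ⟨i, hi⟩ := Finsupp.ne_iff.1 hd
    rw [Finsupp.prod_fintype _ _ fun _ => pow_zero _,
      Finset.prod_eq_zero (Finset.mem_univ i) (zero_pow hi), smul_zero]
  · simp

theorem psEval_tsum {w : ι → K} (hw : ‖w‖ < 1) {c : ℕ → MvPowerSeries ι 𝒪[K]}
    (hc : Summable c) : (psEval hw (∑' k, c k) : K) = ∑' k, (psEval hw (c k) : K) :=
  hc.map_tsum ((Subring.subtype _).comp (psEval hw : MvPowerSeries ι 𝒪[K] →+* 𝒪[K]))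
    (continuous_subtype_val.comp (MvPowerSeries.continuous_aeval (hasEval_toInteger hw)))

omit [Fintype ι] in
theorem summable_pow_smul {ϖ : 𝒪[K]} (hϖ : ‖ϖ‖ < 1) (c : ℕ → MvPowerSeries ι 𝒪[K]) :
    Summable fun k => ϖ ^ k • c k := by
  refine MvPowerSeries.WithPiTopology.summable_iff_summable_coeff.2 fun d => ?_
  refine Summable.of_norm_bounded (summable_geometric_of_lt_one (norm_nonneg ϖ) hϖ) fun k => ?_
  rw [MvPowerSeries.coeff_smul, norm_mul, norm_pow]
  exact mul_le_of_le_one_right (by positivity) (Valued.integer.norm_le_one _)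

end PowerSeriesValues

section Analyticity

open scoped NormedField Valued

variable {K ι : Type*} [NontriviallyNormedField K] [Fintype ι]

theorem exists_prod_eq_prod_pow {M : Type*} [CommMonoid M] {d : ι →₀ ℕ} {k : ℕ}
    (hd : d.degree = k) :
    ∃ idx : Fin k → ι, ∀ x : ι → M, ∏ j, x (idx j) = ∏ i, x i ^ d i := by
  let slots : Fin k ≃ Σ i, Fin (d i) := (Fintype.equivFinOfCardEq <| by
    simp [← hd, Finsupp.degree_eq_sum]).symm
  refine ⟨fun j => (slots j).1, fun x => ?_⟩
  rw [slots.prod_comp fun y => x y.1, Fintype.prod_sigma]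
  simp

theorem exists_continuousMultilinearMap_diag_eq_prod_pow {d : ι →₀ ℕ} {k : ℕ}
    (hd : d.degree = k) :
    ∃ T : (ι → K) [×k]→L[K] K,
      (∀ w, T (fun _ => w) = ∏ i, w i ^ d i) ∧ ∀ v, ‖T v‖ ≤ ∏ j, ‖v j‖ := by
  obtain ⟨idx, hidx⟩ := exists_prod_eq_prod_pow (M := K) hd
  refine ⟨(ContinuousMultilinearMap.mkPiAlgebra K (Fin k) K).compContinuousLinearMap
    fun j => ContinuousLinearMap.proj (R := K) (φ := fun _ : ι => K) (idx j), hidx, fun v => ?_⟩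
  calc ‖∏ j, v j (idx j)‖ = ∏ j, ‖v j (idx j)‖ := norm_prod _ _
    _ ≤ ∏ j, ‖v j‖ :=
      Finset.prod_le_prod (fun _ _ => norm_nonneg _) fun j _ => norm_le_pi_norm (v j) _

variable [IsUltrametricDist K]

theorem exists_formalMultilinearSeries (c : MvPowerSeries ι 𝒪[K]) :
    ∃ P : FormalMultilinearSeries K (ι → K) K, 1 ≤ P.radius ∧ ∀ k w,
      HasSum (fun d : {d : ι →₀ ℕ // d.degree = k} =>
        ((MvPowerSeries.coeff d.1 c : 𝒪[K]) : K) * ∏ i, w i ^ d.1 i) (P k fun _ => w) := by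
  have (k : ℕ) : Fintype {d : ι →₀ ℕ // d.degree = k} := (Finsupp.finite_of_degree_eq k).fintype
  choose T hT hT_le using fun (k : ℕ) (d : {d : ι →₀ ℕ // d.degree = k}) =>
    exists_continuousMultilinearMap_diag_eq_prod_pow (K := K) d.2
  let P : FormalMultilinearSeries K (ι → K) K := fun k =>
    ∑ d : {d : ι →₀ ℕ // d.degree = k}, ((MvPowerSeries.coeff d.1 c : 𝒪[K]) : K) • T k d
  have hP (k : ℕ) (v : Fin k → ι → K) :
      P k v = ∑ d, ((MvPowerSeries.coeff d.1 c : 𝒪[K]) : K) * T k d v := by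
    simp [P]
  refine ⟨P, ?_, fun k w => ?_⟩
  · refine P.le_radius_of_bound 1 (r := 1) fun k => ?_
    rw [NNReal.coe_one, one_pow, mul_one]
    refine ContinuousMultilinearMap.opNorm_le_bound zero_le_one fun v => ?_
    rw [one_mul, hP]
    refine IsUltrametricDist.norm_sum_le_of_forall_le_of_nonneg
      (Finset.prod_nonneg fun _ _ => norm_nonneg _) fun d _ => ?_
    rw [norm_mul]
    exact (mul_le_of_le_one_left (norm_nonneg _) (Valued.integer.norm_le_one _)).trans
      (hT_le k d v)
  · rw [hP]
    simp only [hT]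
    exact hasSum_fintype _

theorem exists_hasFPowerSeriesOnBall [CompleteSpace K] {F : (ι → K) → K} {a : ι → K}
    (c : MvPowerSeries ι 𝒪[K]) (hF : ∀ (w : ι → K) (hw : ‖w‖ < 1), F (a + w) = psEval hw c) :
    ∃ P : FormalMultilinearSeries K (ι → K) K, HasFPowerSeriesOnBall F P a 1 := by
  obtain ⟨P, hP_radius, hP⟩ := exists_formalMultilinearSeries c
  refine ⟨P, hP_radius, one_pos, fun {w} hw => ?_⟩
  have hw : ‖w‖ < 1 := by simpa [← ENNReal.ofReal_one, edist_dist] using hw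
  rw [hF w hw]
  exact ((Equiv.sigmaFiberEquiv fun d : ι →₀ ℕ => d.degree).hasSum_iff.2
    (hasSum_psEval hw c)).sigma fun k => hP k w

end Analyticity

section IntegralAnalytic

open scoped NormedField Valued MvPowerSeries.WithPiTopology

variable {K ι : Type*} [NontriviallyNormedField K] [IsUltrametricDist K] [CompleteSpace K]
  [Fintype ι]

/-- The ring of functions on `D` that are given, at distance less than `1` from each point of `D`,
by a power series with integral coefficients. -/
def integralAnalytic (D : Set (ι → K)) : Subring (D → K) where
  carrier := {f | ∀ a : D, ∃ c : MvPowerSeries ι 𝒪[K],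
    ∀ (b : D) (h : ‖(b : ι → K) - a‖ < 1), f b = psEval h c}
  mul_mem' hf hf' a := by
    obtain ⟨c, hc⟩ := hf a
    obtain ⟨c', hc'⟩ := hf' a
    exact ⟨c * c', fun b h => by simp [hc b h, hc' b h]⟩
  one_mem' a := ⟨1, fun b h => by simp⟩
  add_mem' hf hf' a := by
    obtain ⟨c, hc⟩ := hf a
    obtain ⟨c', hc'⟩ := hf' a
    exact ⟨c + c', fun b h => by simp [hc b h, hc' b h]⟩
  zero_mem' a := ⟨0, fun b h => by simp⟩
  neg_mem' hf a := by
    obtain ⟨c, hc⟩ := hf a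
    exact ⟨-c, fun b h => by simp [hc b h]⟩

variable {D : Set (ι → K)}

/-- Evaluation at a point of `D`, as a ring homomorphism. -/
def evalPt (a : D) : integralAnalytic D →+* K :=
  (Pi.evalRingHom (fun _ : D => K) a).comp (integralAnalytic D).subtype

theorem norm_evalPt_le (a : D) (f : integralAnalytic D) : ‖evalPt a f‖ ≤ 1 := by
  obtain ⟨c, hc⟩ := f.2 a
  have ha : ‖(a : ι → K) - a‖ < 1 := by simp
  exact (congrArg norm (hc a ha)).trans_le (Valued.integer.norm_le_one _)

theorem exists_unit_psEval {f : D → K} (hf : f ∈ integralAnalytic D) {a : D} (ha : ‖f a‖ = 1) :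
    ∃ c : (MvPowerSeries ι 𝒪[K])ˣ,
      ∀ (b : D) (h : ‖(b : ι → K) - a‖ < 1), f b = psEval h (c : MvPowerSeries ι 𝒪[K]) := by
  obtain ⟨c, hc⟩ := hf a
  have h0 : ‖(0 : ι → K)‖ < 1 := by simp
  have hca : f a = MvPowerSeries.constantCoeff c := by
    simp only [hc a (by simp), sub_self, psEval_zero h0]
  have hc_unit : IsUnit c := by
    rw [MvPowerSeries.isUnit_iff_constantCoeff, Valued.integer.isUnit_iff_norm_eq_one, ← ha, hca]
    rfl
  exact ⟨hc_unit.unit, hc⟩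

theorem norm_eq_one_of_norm_sub_lt {f : D → K} (hf : f ∈ integralAnalytic D) {a b : D}
    (h : ‖(b : ι → K) - a‖ < 1) (ha : ‖f a‖ = 1) : ‖f b‖ = 1 := by
  obtain ⟨c, hc⟩ := exists_unit_psEval hf ha
  rw [hc b h]
  exact Valued.integer.isUnit_iff_norm_eq_one.1 (c.isUnit.map (psEval h))

theorem inv_mem_integralAnalytic {f : D → K} (hf : f ∈ integralAnalytic D)
    (h : ∀ a, ‖f a‖ = 1) : f⁻¹ ∈ integralAnalytic D := by
  intro a
  obtain ⟨c, hc⟩ := exists_unit_psEval hf (h a)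
  refine ⟨(c⁻¹ : (MvPowerSeries ι 𝒪[K])ˣ), fun b hb => ?_⟩
  rw [Pi.inv_apply, hc b hb]
  refine inv_eq_of_mul_eq_one_right ?_
  rw [← Subring.coe_mul, ← map_mul, Units.mul_inv, map_one, Subring.coe_one]

omit [CompleteSpace K] [Fintype ι] in
theorem norm_eq_one_of_norm_sub_lt_one {x y : K} (hy : ‖y‖ = 1) (h : ‖x - y‖ < 1) : ‖x‖ = 1 := by
  have hne : ‖x - y‖ ≠ ‖y‖ := (h.trans_eq hy.symm).ne
  rw [← sub_add_cancel x y, IsUltrametricDist.norm_add_eq_max_of_norm_ne_norm hne, hy,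
    max_eq_right h.le]

theorem isUnit_integralAnalytic_iff {f : integralAnalytic D} :
    IsUnit f ↔ ∀ a, ‖evalPt a f‖ = 1 := by
  refine ⟨fun hf a => ?_, fun h => ?_⟩
  · obtain ⟨f', hff'⟩ := hf.exists_right_inv
    have h : ‖evalPt a f‖ * ‖evalPt a f'‖ = 1 := by rw [← norm_mul, ← map_mul, hff']; simp
    nlinarith [norm_evalPt_le a f, norm_evalPt_le a f', norm_nonneg (evalPt a f)]
  · refine IsUnit.of_mul_eq_one ⟨_, inv_mem_integralAnalytic f.2 h⟩
      (Subtype.ext (funext fun a => mul_inv_cancel₀ ?_))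
    exact norm_ne_zero_iff.1 ((h a).trans_ne one_ne_zero)

theorem mem_jacobson_bot_integralAnalytic {x : integralAnalytic D} (hx : ∀ a, ‖evalPt a x‖ < 1) :
    x ∈ Ideal.jacobson (⊥ : Ideal (integralAnalytic D)) := by
  refine Ideal.mem_jacobson_bot.2 fun y => isUnit_integralAnalytic_iff.2 fun a => ?_
  refine norm_eq_one_of_norm_sub_lt_one norm_one ?_
  rw [map_add, map_one, add_sub_cancel_right, map_mul, norm_mul]
  exact (mul_le_of_le_one_right (norm_nonneg _) (norm_evalPt_le a y)).trans_lt (hx a)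

theorem const_mem_integralAnalytic {x : K} (hx : ‖x‖ ≤ 1) :
    Function.const D x ∈ integralAnalytic D := fun _ =>
  ⟨MvPowerSeries.C ⟨x, Valued.integer.mem_iff.2 hx⟩, fun _ h => by
    simp [MvPowerSeries.c_eq_algebraMap]⟩

theorem coord_mem_integralAnalytic {i : ι} (hD : ∀ a ∈ D, ‖a i‖ ≤ 1) :
    (fun a : D => (a : ι → K) i) ∈ integralAnalytic D := fun a =>
  ⟨MvPowerSeries.C ⟨a.1 i, Valued.integer.mem_iff.2 (hD a a.2)⟩ + MvPowerSeries.X i, fun b h => by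
    simp [MvPowerSeries.c_eq_algebraMap, psEval_X]⟩

theorem tsum_pow_mul_mem_integralAnalytic {ϖ : K} (hϖ : ‖ϖ‖ < 1) {f : ℕ → D → K}
    (hf : ∀ k, f k ∈ integralAnalytic D) :
    (fun a => ∑' k, ϖ ^ k * f k a) ∈ integralAnalytic D := by
  intro a
  choose c hc using fun k => hf k a
  let ϖ' : 𝒪[K] := ⟨ϖ, Valued.integer.mem_iff.2 hϖ.le⟩
  refine ⟨∑' k, ϖ' ^ k • c k, fun b hb => ?_⟩
  rw [psEval_tsum hb (summable_pow_smul (ϖ := ϖ') hϖ c)]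
  refine tsum_congr fun k => ?_
  rw [map_smul, hc k b hb]
  rfl

end IntegralAnalytic

section Limits

open scoped NormedField Valued

variable {K ι : Type*} [NontriviallyNormedField K] [IsUltrametricDist K] [CompleteSpace K]
  [Fintype ι] {D : Set (ι → K)} {p : ℕ}

theorem natCast_mem_jacobson_bot_integralAnalytic (hp : ‖(p : K)‖ < 1) :
    (p : integralAnalytic D) ∈ Ideal.jacobson (⊥ : Ideal (integralAnalytic D)) :=
  mem_jacobson_bot_integralAnalytic fun a => by rwa [map_natCast]

theorem exists_natCast_pow_dvd_sub (hp : ‖(p : K)‖ < 1) {f : ℕ → integralAnalytic D}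
    (hf : ∀ s, ((p ^ (s + 1) : ℕ) : integralAnalytic D) ∣ f (s + 1) - f s) :
    ∃ L, ∀ s, ((p ^ (s + 1) : ℕ) : integralAnalytic D) ∣ L - f s := by
  choose c hc using hf
  let tail (s : ℕ) : integralAnalytic D :=
    ⟨_, tsum_pow_mul_mem_integralAnalytic hp fun k => (c (k + s)).2⟩
  have htail (s : ℕ) : tail s = c s + (p : integralAnalytic D) * tail (s + 1) := by
    refine Subtype.ext (funext fun a => ?_)
    have hsum : Summable fun k => (p : K) ^ k * evalPt a (c (k + s)) := by
      refine .of_norm_bounded (summable_geometric_of_lt_one (norm_nonneg _) hp) fun k => ?_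
      rw [norm_mul, norm_pow]
      exact mul_le_of_le_one_right (by positivity) (norm_evalPt_le a _)
    change ∑' k, (p : K) ^ k * evalPt a (c (k + s)) = evalPt a (c s + p * tail (s + 1))
    rw [hsum.tsum_eq_zero_add, map_add, map_mul, map_natCast, pow_zero, one_mul, zero_add]
    congr 1
    simp only [pow_succ', mul_assoc, tsum_mul_left, add_right_comm _ 1 s]
    rfl
  refine ⟨f 0 + (p : integralAnalytic D) * tail 0, fun s => ⟨tail s, ?_⟩⟩
  induction s with
  | zero => simp
  | succ s ih =>
    have hstep := hc s
    rw [Nat.cast_pow] at ih hstep ⊢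
    linear_combination ih - hstep + (p : integralAnalytic D) ^ (s + 1) * htail s

theorem exists_natCast_pow_dvd_matrix_sub {κ : Type*} [Fintype κ] [DecidableEq κ]
    (hp : ‖(p : K)‖ < 1) {Q : ℕ → Matrix κ κ (integralAnalytic D)}
    (hQ : ∀ s, ((p ^ (s + 1) : ℕ) : Matrix κ κ (integralAnalytic D)) ∣ Q (s + 1) - Q s) :
    ∃ L, ∀ s, ((p ^ (s + 1) : ℕ) : Matrix κ κ (integralAnalytic D)) ∣ L - Q s := by
  choose L hL using fun i j => exists_natCast_pow_dvd_sub hp (f := fun s => Q s i j)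
    fun s => natCast_dvd_matrix_iff.1 (hQ s) i j
  exact ⟨Matrix.of L, fun s => natCast_dvd_matrix_iff.2 fun i j => hL i j s⟩

theorem tendstoUniformly_evalPt (hp : ‖(p : K)‖ < 1) {f : ℕ → integralAnalytic D}
    {L : integralAnalytic D} (hL : ∀ s, ((p ^ (s + 1) : ℕ) : integralAnalytic D) ∣ L - f s) :
    TendstoUniformly (fun s a => evalPt a (f s)) (fun a => evalPt a L) Filter.atTop := by
  have hbound (s : ℕ) (a : D) : dist (evalPt a L) (evalPt a (f s)) ≤ ‖(p : K)‖ ^ s := by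
    obtain ⟨c, hc⟩ := hL s
    rw [dist_eq_norm, ← map_sub, hc, map_mul, map_natCast, norm_mul, Nat.cast_pow, norm_pow,
      pow_succ, mul_assoc]
    exact mul_le_of_le_one_right (by positivity)
      (mul_le_one₀ hp.le (norm_nonneg _) (norm_evalPt_le a c))
  refine Metric.tendstoUniformly_iff.2 fun ε hε => ?_
  filter_upwards [(tendsto_pow_atTop_nhds_zero_of_lt_one (norm_nonneg _) hp).eventually_lt_const hε]
    with s hs a
  exact (hbound s a).trans_lt hs

theorem exists_hasFPowerSeriesOnBall_of_eq_evalPt {f : integralAnalytic D} {F : (ι → K) → K}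
    (hF : ∀ b : D, F b = evalPt b f) {a : ι → K} (ha : a ∈ D) (hball : Metric.ball a 1 ⊆ D) :
    ∃ P : FormalMultilinearSeries K (ι → K) K, HasFPowerSeriesOnBall F P a 1 := by
  obtain ⟨c, hc⟩ := f.2 ⟨a, ha⟩
  refine exists_hasFPowerSeriesOnBall c fun w hw => ?_
  have hmem : a + w ∈ D := hball (by simpa [Metric.mem_ball, dist_eq_norm] using hw)
  have h := (hF ⟨a + w, hmem⟩).trans (hc ⟨a + w, hmem⟩ (by simpa using hw))
  simpa only [add_sub_cancel_left] using h

end Limits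

section Evaluation

variable {R K ι : Type*} [CommRing R] [Fintype ι]

/-- The exponents that are negative only at places in `I`. -/
def negOn (I : Set ι) : AddSubmonoid (ι → ℤ) where
  carrier := {d | ∀ i ∉ I, 0 ≤ d i}
  add_mem' hx hy i hi := add_nonneg (hx i hi) (hy i hi)
  zero_mem' _ _ := le_rfl

/-- The value at `a` of a Laurent polynomial whose coefficients are mapped to `K` by `f`. It is
only additive in the polynomial if some `a i` is zero. -/
def evalLaurent [Field K] (f : R →+* K) (a : ι → K) : AddMonoidAlgebra R (ι → ℤ) →+ K :=
  AddMonoidAlgebra.liftNC (f : R →+ K) fun d => ∏ i, a i ^ d.toAdd i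

theorem evalLaurent_apply [Field K] (f : R →+* K) (a : ι → K) (G : AddMonoidAlgebra R (ι → ℤ)) :
    evalLaurent f a G = ∑ d ∈ G.coeff.support, f (G.coeff d) * ∏ i, a i ^ d i :=
  rfl

theorem prod_zpow_add_of_mem_negOn [Field K] {I : Set ι} {a : ι → K} (ha : ∀ i ∈ I, a i ≠ 0)
    {d d' : ι → ℤ} (hd : d ∈ negOn I) (hd' : d' ∈ negOn I) :
    ∏ i, a i ^ (d + d') i = (∏ i, a i ^ d i) * ∏ i, a i ^ d' i := by
  rw [← Finset.prod_mul_distrib]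
  refine Finset.prod_congr rfl fun i _ => ?_
  by_cases hi : i ∈ I
  · exact zpow_add₀ (ha i hi) _ _
  · obtain ⟨x, hx⟩ := Int.eq_ofNat_of_zero_le (hd i hi)
    obtain ⟨y, hy⟩ := Int.eq_ofNat_of_zero_le (hd' i hi)
    rw [Pi.add_apply, hx, hy, ← Nat.cast_add, zpow_natCast, zpow_natCast, zpow_natCast, pow_add]

theorem evalLaurent_mul [Field K] (f : R →+* K) {I : Set ι} {a : ι → K} (ha : ∀ i ∈ I, a i ≠ 0)
    {F G : AddMonoidAlgebra R (ι → ℤ)} (hF : F ∈ supportSubring R (negOn I))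
    (hG : G ∈ supportSubring R (negOn I)) :
    evalLaurent f a (F * G) = evalLaurent f a F * evalLaurent f a G := by
  have hmul : F * G = ∑ d ∈ F.coeff.support, ∑ d' ∈ G.coeff.support,
      AddMonoidAlgebra.single (d + d') (F.coeff d * G.coeff d') := by
    simp only [← AddMonoidAlgebra.single_mul_single, ← Finset.sum_mul_sum]
    exact congrArg₂ _ (AddMonoidAlgebra.sum_coeff_single F).symm
      (AddMonoidAlgebra.sum_coeff_single G).symm
  rw [hmul, evalLaurent_apply f a F, evalLaurent_apply f a G, Finset.sum_mul_sum, map_sum]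
  simp only [map_sum]
  refine Finset.sum_congr rfl fun d hd => Finset.sum_congr rfl fun d' hd' => ?_
  have hd : d ∈ negOn I := hF d (Finsupp.mem_support_iff.1 hd)
  have hd' : d' ∈ negOn I := hG d' (Finsupp.mem_support_iff.1 hd')
  rw [mul_mul_mul_comm, ← map_mul, ← prod_zpow_add_of_mem_negOn ha hd hd']
  exact AddMonoidAlgebra.liftNC_single _ _ _ _

/-- Evaluation at a point whose coordinates in `I` are nonzero, as a ring homomorphism on the
Laurent polynomials with exponents in `negOn I`. -/
def evalHom [Field K] (f : R →+* K) {I : Set ι} {a : ι → K} (ha : ∀ i ∈ I, a i ≠ 0) :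
    supportSubring R (negOn I) →+* K where
  toFun G := evalLaurent f a G
  map_one' := (AddMonoidAlgebra.liftNC_single _ _ _ _).trans (by simp)
  map_mul' F G := evalLaurent_mul f ha F.2 G.2
  map_zero' := map_zero _
  map_add' _ _ := map_add _ _ _

section Norm

variable [NontriviallyNormedField K] {I : Set ι}

variable (K) in
/-- The integral points at which Laurent polynomials with exponents in `negOn I` and integral
coefficients take integral values. -/
def integralPoints (I : Set ι) : Set (ι → K) :=
  {a | (∀ i, ‖a i‖ ≤ 1) ∧ ∀ i ∈ I, ‖a i‖ = 1}

omit [Fintype ι] in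
theorem ne_zero_of_mem_integralPoints {a : ι → K} (ha : a ∈ integralPoints K I) {i : ι}
    (hi : i ∈ I) : a i ≠ 0 :=
  norm_ne_zero_iff.1 ((ha.2 i hi).trans_ne one_ne_zero)

variable [IsUltrametricDist K]

theorem ball_subset_integralPoints {a : ι → K} (ha : a ∈ integralPoints K I) :
    Metric.ball a 1 ⊆ integralPoints K I := by
  intro b hb
  have hab (i : ι) : ‖b i - a i‖ < 1 :=
    (norm_le_pi_norm (b - a) i).trans_lt (mem_ball_iff_norm.1 hb)
  refine ⟨fun i => ?_, fun i hi => norm_eq_one_of_norm_sub_lt_one (ha.2 i hi) (hab i)⟩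
  rw [← sub_add_cancel (b i) (a i)]
  exact (IsUltrametricDist.norm_add_le_max _ _).trans (max_le (hab i).le (ha.1 i))

variable [CompleteSpace K] {D : Set (ι → K)}

theorem zpow_coord_mem_integralAnalytic (hD : D ⊆ integralPoints K I) {d : ι → ℤ}
    (hd : d ∈ negOn I) (i : ι) : (fun a : D => a.1 i ^ d i) ∈ integralAnalytic D := by
  have hcoord : (fun a : D => a.1 i) ∈ integralAnalytic D :=
    coord_mem_integralAnalytic fun a ha => (hD ha).1 i
  obtain ⟨k, hk | hk⟩ := Int.eq_nat_or_neg (d i)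
  · simpa only [hk, zpow_natCast] using! Subring.pow_mem _ hcoord k
  · by_cases hi : i ∈ I
    · simpa only [hk, zpow_neg, zpow_natCast, ← inv_pow] using!
        Subring.pow_mem _ (inv_mem_integralAnalytic hcoord fun a => (hD a.2).2 i hi) k
    · have hdi : d i = 0 := le_antisymm (by omega) (hd i hi)
      simpa only [hdi, zpow_zero] using! (integralAnalytic D).one_mem

variable {f : R →+* K} (hf : ∀ c, ‖f c‖ ≤ 1)

include hf in
theorem evalLaurent_mem_integralAnalytic (hD : D ⊆ integralPoints K I)
    {G : AddMonoidAlgebra R (ι → ℤ)} (hG : G ∈ supportSubring R (negOn I)) :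
    (fun a : D => evalLaurent f a.1 G) ∈ integralAnalytic D := by
  have hsum : (fun a : D => evalLaurent f a.1 G) = ∑ d ∈ G.coeff.support,
      Function.const D (f (G.coeff d)) * ∏ i, fun a : D => a.1 i ^ d i := by
    funext a
    simp only [Finset.sum_apply, Pi.mul_apply, Finset.prod_apply, evalLaurent_apply,
      Function.const_apply]
  rw [hsum]
  exact Subring.sum_mem _ fun d hd => Subring.mul_mem _ (const_mem_integralAnalytic (hf _))
    (Subring.prod_mem _ fun i _ =>
      zpow_coord_mem_integralAnalytic hD (hG d (Finsupp.mem_support_iff.1 hd)) i)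

/-- Evaluation on `D`, as a ring homomorphism to the integral analytic functions on `D`. -/
def evalOn (hD : D ⊆ integralPoints K I) : supportSubring R (negOn I) →+* integralAnalytic D :=
  (RingHom.pi fun a : D =>
    evalHom f fun _ => ne_zero_of_mem_integralPoints (hD a.2)).codRestrict _
      fun G => evalLaurent_mem_integralAnalytic hf hD G.2

theorem evalPt_evalOn (hD : D ⊆ integralPoints K I) (a : D) (G : supportSubring R (negOn I)) :
    evalPt a (evalOn hf hD G) = evalLaurent f a.1 G :=
  rfl

include hf in
theorem norm_evalLaurent_eq_one_of_mem_ball {G : AddMonoidAlgebra R (ι → ℤ)}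
    (hG : G ∈ supportSubring R (negOn I)) {a b : ι → K} (ha : a ∈ integralPoints K I)
    (hb : b ∈ Metric.ball a 1) (h : ‖evalLaurent f a G‖ = 1) : ‖evalLaurent f b G‖ = 1 :=
  norm_eq_one_of_norm_sub_lt (evalLaurent_mem_integralAnalytic hf subset_rfl hG)
    (a := ⟨a, ha⟩) (b := ⟨b, ball_subset_integralPoints ha hb⟩) (mem_ball_iff_norm.1 hb) h

end Norm

end Evaluation

section CompleteExtensions

variable {p : ℕ} [Fact p.Prime] {r n g : ℕ} {K : Type*} [NontriviallyNormedField K]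
  [NormedAlgebra ℚ_[p] K]

variable (p K) in
/-- The inclusion of `ℤ_p` in an extension of `ℚ_p`. -/
def padicIntHom : ℤ_[p] →+* K := (algebraMap ℚ_[p] K).comp PadicInt.Coe.ringHom

theorem norm_padicIntHom_le (c : ℤ_[p]) : ‖padicIntHom p K c‖ ≤ 1 :=
  (norm_algebraMap' K (c : ℚ_[p])).trans_le c.2

variable (p K) in
theorem norm_natCast_prime_lt_one : ‖(p : K)‖ < 1 := by
  rw [← map_natCast (algebraMap ℚ_[p] K), norm_algebraMap']
  exact Padic.norm_p_lt_one

/-- The variables `z_i` that occur with a negative exponent in some `Λ_l`. -/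
def negVars (Λ : ℕ → LaurentTZ p r n) : Set (Fin n) :=
  {i | ∃ l, ∃ k ∈ (Λ l).coeff.support, k.2 i < 0}

theorem mem_supportSubring_negVars (Λ : ℕ → LaurentTZ p r n) (l : ℕ) :
    Λ l ∈ supportSubring ℤ_[p]
      ((negOn (negVars Λ)).comap (AddMonoidHom.snd (Fin r → ℤ) (Fin n → ℤ))) := by
  intro k hk i hi
  contrapose! hi
  exact ⟨l, k, Finsupp.mem_support_iff.2 hk, hi⟩

variable (K) in
/-- The domain `𝔇` over an arbitrary extension `K` of `ℚ_p`; for `K = ℚ_p^{(m)}` it is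
`domainD m e Δ Λ`. -/
def domainOver (e : ℕ → ℕ) (Δ : ℕ → Fin g ↪ (Fin r → ℤ)) (Λ : ℕ → LaurentTZ p r n) :
    Set (Fin n → K) :=
  {a | (∀ i, ‖a i‖ ≤ 1) ∧ (∀ i ∈ negVars Λ, ‖a i‖ = 1) ∧
    ∀ l, ‖evalLaurent (padicIntHom p K) a (basicDet e Δ Λ l)‖ = 1}

/-- The counterpart of `ratioAt` at a point with coordinates in an arbitrary extension `K` of
`ℚ_p`. -/
def ratioOver (e : ℕ → ℕ) (Δ : ℕ → Fin g ↪ (Fin r → ℤ)) (Λ : ℕ → LaurentTZ p r n) (s : ℕ)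
    (a : Fin n → K) : Matrix (Fin g) (Fin g) K :=
  (matA e Δ Λ 0 s).map (evalLaurent (padicIntHom p K) a) *
    ((sigmaMatA e Δ Λ s).map (evalLaurent (padicIntHom p K) a))⁻¹

variable {e : ℕ → ℕ} {Δ : ℕ → Fin g ↪ (Fin r → ℤ)} {Λ : ℕ → LaurentTZ p r n}

theorem domainOver_subset_integralPoints :
    domainOver K e Δ Λ ⊆ integralPoints K (negVars Λ) := fun _ ha => ⟨ha.1, ha.2.1⟩

variable [IsUltrametricDist K] [CompleteSpace K]

theorem ball_subset_domainOver {a : Fin n → K} (ha : a ∈ domainOver K e Δ Λ) :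
    Metric.ball a 1 ⊆ domainOver K e Δ Λ := by
  intro b hb
  have ha' := domainOver_subset_integralPoints ha
  have hb' := ball_subset_integralPoints ha' hb
  refine ⟨hb'.1, hb'.2, fun l => ?_⟩
  have hd : basicDet e Δ Λ l ∈ supportSubring ℤ_[p] (negOn (negVars Λ)) := by
    have h := (hasseWittOn (mem_supportSubring_negVars Λ l) (e (l + 1)) (Δ l) (Δ (l + 1))).det.2
    rwa [coe_det] at h
  exact norm_evalLaurent_eq_one_of_mem_ball norm_padicIntHom_le hd ha' hb (ha.2.2 l)

variable (K e Δ Λ) in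
/-- Evaluation of Laurent polynomials at the points of `𝔇`, as a ring homomorphism. -/
def evalDomain :
    supportSubring ℤ_[p] (negOn (negVars Λ)) →+* integralAnalytic (domainOver K e Δ Λ) :=
  evalOn norm_padicIntHom_le domainOver_subset_integralPoints

theorem evalPt_evalDomain (a : domainOver K e Δ Λ)
    (G : supportSubring ℤ_[p] (negOn (negVars Λ))) :
    evalPt a (evalDomain K e Δ Λ G) = evalLaurent (padicIntHom p K) a.1 (G : LaurentZ p n) :=
  evalPt_evalOn norm_padicIntHom_le domainOver_subset_integralPoints a G

theorem isUnit_evalDomain_twistedMatA (he : ∀ l, 0 < e (l + 1)) (hadm : Admissible e Δ Λ)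
    {i s : ℕ} (his : i ≤ s + 1) :
    IsUnit ((evalDomain K e Δ Λ).mapMatrix
      (twistedMatA (mem_supportSubring_negVars Λ) e Δ i s)) := by
  have hp : (p : integralAnalytic (domainOver K e Δ Λ)) ∈ Ideal.jacobson ⊥ :=
    natCast_mem_jacobson_bot_integralAnalytic (norm_natCast_prime_lt_one p K)
  refine isUnit_mapMatrix_twistedMatA _ he hadm (evalDomain K e Δ Λ) hp
    (fun l => isUnit_integralAnalytic_iff.2 fun a => ?_) his
  rw [evalPt_evalDomain, coe_det]
  exact a.2.2.2 l

theorem map_evalLaurent_matA (a : domainOver K e Δ Λ) (s : ℕ) :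
    (matA e Δ Λ 0 s).map (evalLaurent (padicIntHom p K) a.1) = (evalPt a).mapMatrix
      ((evalDomain K e Δ Λ).mapMatrix (twistedMatA (mem_supportSubring_negVars Λ) e Δ 0 s)) :=
  Matrix.ext fun u v => by
    simp only [RingHom.mapMatrix_apply, Matrix.map_apply, evalPt_evalDomain, coe_twistedMatA_zero]

theorem map_evalLaurent_sigmaMatA (a : domainOver K e Δ Λ) (s : ℕ) :
    (sigmaMatA e Δ Λ s).map (evalLaurent (padicIntHom p K) a.1) = (evalPt a).mapMatrix
      ((evalDomain K e Δ Λ).mapMatrix (twistedMatA (mem_supportSubring_negVars Λ) e Δ 1 s)) :=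
  Matrix.ext fun u v => by
    simp only [RingHom.mapMatrix_apply, Matrix.map_apply, evalPt_evalDomain, coe_twistedMatA_one]

theorem det_map_evalLaurent_sigmaMatA {a : Fin n → K} (ha : a ∈ domainOver K e Δ Λ) (s : ℕ) :
    ((sigmaMatA e Δ Λ s).map (evalLaurent (padicIntHom p K) a)).det =
      evalLaurent (padicIntHom p K) a (sigmaMatA e Δ Λ s).det := by
  rw [map_evalLaurent_sigmaMatA ⟨a, ha⟩, ← RingHom.map_det, ← RingHom.map_det, evalPt_evalDomain,
    det_sigmaMatA (mem_supportSubring_negVars Λ)]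

theorem norm_evalLaurent_det_sigmaMatA (he : ∀ l, 0 < e (l + 1)) (hadm : Admissible e Δ Λ)
    {a : Fin n → K} (ha : a ∈ domainOver K e Δ Λ) (s : ℕ) :
    ‖evalLaurent (padicIntHom p K) a (sigmaMatA e Δ Λ s).det‖ = 1 := by
  have hdet := (Matrix.isUnit_iff_isUnit_det _).1
    (isUnit_evalDomain_twistedMatA (K := K) he hadm (show 1 ≤ s + 1 by omega))
  rw [← det_map_evalLaurent_sigmaMatA ha, map_evalLaurent_sigmaMatA ⟨a, ha⟩, ← RingHom.map_det]
  exact isUnit_integralAnalytic_iff.1 hdet ⟨a, ha⟩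

variable (K) in
theorem exists_units_ratioOver_eq (he : ∀ l, 0 < e (l + 1)) (hadm : Admissible e Δ Λ) :
    ∃ Q : ℕ → (Matrix (Fin g) (Fin g) (integralAnalytic (domainOver K e Δ Λ)))ˣ,
      (∀ s, ((p ^ (s + 1) : ℕ) : Matrix (Fin g) (Fin g) (integralAnalytic (domainOver K e Δ Λ))) ∣
        (Q (s + 1)).val - (Q s).val) ∧
      ∀ s (a : domainOver K e Δ Λ), ratioOver e Δ Λ s a.1 = (evalPt a).mapMatrix (Q s).val := by
  have hunit (i s : ℕ) : ∃ u : (Matrix (Fin g) (Fin g) (integralAnalytic (domainOver K e Δ Λ)))ˣ,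
      i ≤ s + 1 → u.val = (evalDomain K e Δ Λ).mapMatrix
        (twistedMatA (mem_supportSubring_negVars Λ) e Δ i s) := by
    by_cases his : i ≤ s + 1
    · exact ⟨(isUnit_evalDomain_twistedMatA he hadm his).unit, fun _ => rfl⟩
    · exact ⟨1, fun h => absurd h his⟩
  choose u hu using hunit
  obtain ⟨b, hsys, -⟩ := exists_isDworkSystem_twistedMatA (Δ := Δ)
    (mem_supportSubring_negVars Λ) he hadm
  refine ⟨fun s => u 0 s * (u 1 s)⁻¹, fun s =>
    (hsys.map (evalDomain K e Δ Λ).mapMatrix).natCast_pow_dvd_ratio_sub hu (Nat.zero_le s),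
    fun s a => ?_⟩
  have hinv := Matrix.coe_units_inv (Units.map (evalPt a).mapMatrix.toMonoidHom (u 1 s))
  rw [ratioOver, map_evalLaurent_matA, map_evalLaurent_sigmaMatA, ← hu 0 s (by omega),
    ← hu 1 s (by omega), Units.val_mul, map_mul]
  exact congrArg _ hinv.symm

variable (K) in
theorem exists_tendstoUniformly_ratioOver (he : ∀ l, 0 < e (l + 1)) (hadm : Admissible e Δ Λ) :
    ∃ L : Matrix (Fin g) (Fin g) (integralAnalytic (domainOver K e Δ Λ)), IsUnit L ∧
      ∀ i j, TendstoUniformly (fun s (a : domainOver K e Δ Λ) => ratioOver e Δ Λ s a.1 i j)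
        (fun a => evalPt a (L i j)) Filter.atTop := by
  have hp := norm_natCast_prime_lt_one p K
  have hp_jac : (p : integralAnalytic (domainOver K e Δ Λ)) ∈ Ideal.jacobson ⊥ :=
    natCast_mem_jacobson_bot_integralAnalytic hp
  obtain ⟨Q, hQ, hratio⟩ := exists_units_ratioOver_eq K he hadm
  obtain ⟨L, hL⟩ := exists_natCast_pow_dvd_matrix_sub hp (Q := fun s => (Q s).val) hQ
  have hL_zero := hL 0
  rw [zero_add, pow_one] at hL_zero
  refine ⟨L, isUnit_matrix_of_natCast_dvd_sub hp_jac hL_zero (Q 0).isUnit, fun i j => ?_⟩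
  simp only [hratio]
  exact tendstoUniformly_evalPt hp fun s => natCast_dvd_matrix_iff.1 (hL s) i j

end CompleteExtensions

theorem completeSpace_Qpm {p : ℕ} [Fact p.Prime] {m : ℕ} (hm : 0 < m) :
    CompleteSpace (Qpm p m) := by
  have hpm : 0 < p ^ m - 1 :=
    Nat.sub_pos_of_lt (Nat.one_lt_pow hm.ne' (Fact.out : p.Prime).one_lt)
  have : Finite {ζ : PadicAlgCl p | ζ ^ (p ^ m - 1) = 1} :=
    (Polynomial.nthRootsFinset (p ^ m - 1) (1 : PadicAlgCl p)).finite_toSet.subset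
      fun _ hζ => (Polynomial.mem_nthRootsFinset hpm _).2 hζ
  have : FiniteDimensional ℚ_[p] (Qpm p m) :=
    IntermediateField.finiteDimensional_adjoin fun x _ => Algebra.IsIntegral.isIntegral x
  exact FiniteDimensional.complete ℚ_[p] (Qpm p m)


end Dwork

end

open Dwork in
theorem mainTheorem6_general {p : ℕ} [Fact p.Prime] {K : Type*} [NontriviallyNormedField K]
    [NormedAlgebra ℚ_[p] K] [CompleteSpace K] {r n g : ℕ} {e : ℕ → ℕ} (he : ∀ l, 0 < e (l + 1))
    {Δ : ℕ → Fin g ↪ (Fin r → ℤ)} {Λ : ℕ → LaurentTZ p r n}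
    (hadm : Admissible e Δ Λ) (hnd : Nondegenerate e Δ Λ) :
    (∀ s, NonzeroModP (sigmaMatA e Δ Λ s).det ∧
      ∀ a ∈ domainOver K e Δ Λ,
        ‖evalLaurent (padicIntHom p K) a (sigmaMatA e Δ Λ s).det‖ = 1 ∧
        ((sigmaMatA e Δ Λ s).map (evalLaurent (padicIntHom p K) a)).det =
          evalLaurent (padicIntHom p K) a (sigmaMatA e Δ Λ s).det) ∧
    ∃ 𝓐 : (Fin n → K) → Matrix (Fin g) (Fin g) K,
      (∀ i j, TendstoUniformlyOn (fun s a => ratioOver e Δ Λ s a i j) (fun a => 𝓐 a i j)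
        Filter.atTop (domainOver K e Δ Λ)) ∧
      (∀ a ∈ domainOver K e Δ Λ,
        Metric.ball a 1 ⊆ domainOver K e Δ Λ ∧
        ∀ i j, ∃ P : FormalMultilinearSeries K (Fin n → K) K,
          HasFPowerSeriesOnBall (fun z => 𝓐 z i j) P a 1) ∧
      ∀ a ∈ domainOver K e Δ Λ,
        (∀ i j, ‖𝓐 a i j‖ ≤ 1) ∧ ‖(𝓐 a).det‖ = 1 ∧ IsUnit (𝓐 a) := by
  have : IsUltrametricDist K := IsUltrametricDist.of_normedAlgebra ℚ_[p]
  refine ⟨fun s => ⟨nonzeroModP_det_sigmaMatA he hadm hnd s, fun a ha =>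
    ⟨norm_evalLaurent_det_sigmaMatA he hadm ha s,
      det_map_evalLaurent_sigmaMatA ha s⟩⟩, ?_⟩
  obtain ⟨L, hL_unit, hL_lim⟩ := exists_tendstoUniformly_ratioOver K he hadm
  let 𝓐 : (Fin n → K) → Matrix (Fin g) (Fin g) K :=
    Function.extend Subtype.val (fun a => (evalPt a).mapMatrix L) 0
  have h𝓐 (a : domainOver K e Δ Λ) : 𝓐 a = (evalPt a).mapMatrix L :=
    Subtype.val_injective.extend_apply _ _ a
  refine ⟨𝓐, fun i j => ?_, fun a ha => ⟨ball_subset_domainOver ha, fun i j => ?_⟩,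
    fun a ha => ?_⟩
  · rw [tendstoUniformlyOn_iff_tendstoUniformly_comp_coe]
    convert hL_lim i j using 1
    exact funext fun a => congrFun₂ (h𝓐 a) i j
  · exact exists_hasFPowerSeriesOnBall_of_eq_evalPt (f := L i j)
      (fun b => congrFun₂ (h𝓐 b) i j) ha (ball_subset_domainOver ha)
  · have hdet : ‖(𝓐 a).det‖ = 1 := by
      rw [h𝓐 ⟨a, ha⟩, ← RingHom.map_det]
      exact isUnit_integralAnalytic_iff.1 ((Matrix.isUnit_iff_isUnit_det _).1 hL_unit) ⟨a, ha⟩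
    refine ⟨fun i j => ?_, hdet, ?_⟩
    · rw [h𝓐 ⟨a, ha⟩]
      exact norm_evalPt_le ⟨a, ha⟩ (L i j)
    · rw [Matrix.isUnit_iff_isUnit_det, isUnit_iff_ne_zero, ← norm_ne_zero_iff, hdet]
      exact one_ne_zero

theorem mainTheorem6 (p : ℕ) [Fact p.Prime] (hp : p ≠ 2) (m : ℕ) (hm : 0 < m)
    (r n g : ℕ) (hg : 0 < g)
    (e : ℕ → ℕ) (he : ∀ l, 0 < e (l + 1))
    (Δ : ℕ → Fin g ↪ (Fin r → ℤ)) (Λ : ℕ → Dwork.LaurentTZ p r n)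
    (he_fin : (Set.range fun l => e (l + 1)).Finite)
    (hΔ_fin : (Set.range fun l => Set.range (Δ l)).Finite)
    (hΛ_fin : (Set.range Λ).Finite)
    (hadm : Dwork.Admissible e Δ Λ) (hnd : Dwork.Nondegenerate e Δ Λ) :
    -- the entries of the matrices are rational functions regular on the domain
    (∀ s, Dwork.NonzeroModP (Dwork.sigmaMatA e Δ Λ s).det ∧
      ∀ a ∈ Dwork.domainD m e Δ Λ,
        ‖Dwork.evalAt a (Dwork.sigmaMatA e Δ Λ s).det‖ = 1 ∧
        ((Dwork.sigmaMatA e Δ Λ s).map (Dwork.evalAt a)).det =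
          Dwork.evalAt a (Dwork.sigmaMatA e Δ Λ s).det) ∧
    ∃ 𝓐 : (Fin n → Dwork.Qpm p m) → Matrix (Fin g) (Fin g) (Dwork.Qpm p m),
      -- uniform convergence
      (∀ i j, TendstoUniformlyOn (fun s a => Dwork.ratioAt e Δ Λ s a i j) (fun a => 𝓐 a i j)
        Filter.atTop (Dwork.domainD m e Δ Λ)) ∧
      -- the limit is given by a convergent power series on each unit polydisc of the domain
      (∀ a ∈ Dwork.domainD m e Δ Λ,
        Metric.ball a 1 ⊆ Dwork.domainD m e Δ Λ ∧
        ∀ i j, ∃ P : FormalMultilinearSeries (Dwork.Qpm p m) (Fin n → Dwork.Qpm p m)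
            (Dwork.Qpm p m),
          HasFPowerSeriesOnBall (fun z => 𝓐 z i j) P a 1) ∧
      ∀ a ∈ Dwork.domainD m e Δ Λ,
        (∀ i j, ‖𝓐 a i j‖ ≤ 1) ∧ ‖(𝓐 a).det‖ = 1 ∧ IsUnit (𝓐 a) := by
  have := Dwork.completeSpace_Qpm (p := p) hm
  exact mainTheorem6_general (K := Dwork.Qpm p m) he hadm hnd
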